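/- There is an absolute constant $K>0$ such that the following holds. **Setting.** Let $n\ge 2$ agents and a dimension $d\ge 1$ be given. Let $W=(w_{ij})\in\mathbb R^{n\times n}$ be primitive and doubly stochastic, $J=\frac1n\mathbf 1\mathbf 1^\top$ and $\lambda=\|W-J\|$ (spectral norm). Let $f_1,\dots,f_n:\mathbb R^d\to\mathbb R$ be differentiable with $\|\nabla f_i(x)-\nabla f_i(y)\|\le L\|x-y\|$ for all $x,y$, where $L>0$, and let $f=\frac1n\sum_i f_i$ be bounded below, $f^\star=\inf f$. **Method (GT-DSGD).** From deterministic $x_1^1,\dots,x_n^1\in\mathbb R^d$ and $y_i^0=g_i^0=0$, with constant step-size $\alpha>0$, for $t=1,2,\dots$ $$g_i^t=G_i(x_i^t,\xi_i^t),\qquad y_i^t=\sum_{j}w_{ij}\,(y_j^{t-1}+g_j^t-g_j^{t-1}),\qquad x_i^{t+1}=\sum_j w_{ij}\,(x_j^t-\alpha y_j^t),$$ where $G_i$ is the (measurable) stochastic first-order oracle of agent $i$ and the random samples $\xi_i^t$ are independent across agents and iterations. Put $z_i^t=g_i^t-\nabla f_i(x_i^t)$ and $\mathcal F_t=\sigma(x_i^s:\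 i\in[n],\ 1\le s\le t)$. **Noise.** For some $\sigma_1,\dots,\sigma_n>0$, $\rho\ge 0$, $\varepsilon>0$ and all $t\ge1$, $i\in[n]$, almost surely $$\mathbb E[z_i^t\mid\mathcal F_t]=0,\qquad \mathbb E\Big[\exp\Big(\frac{\|z_i^t\|^2}{\sigma_i^2}\Big)\,\Big|\,\mathcal F_t\Big]\le\exp\big(1+\alpha^{2+\varepsilon}\rho\,\|\nabla f(x_i^t)\|\big).$$ **Notation.** $\sigma^2=\frac1n\sum_i\sigma_i^2$, $\sigma_{\max}^2=\max_i\sigma_i^2$, $\bar x^1=\frac1n\sum_i x_i^1$, $\Delta_f=f(\bar x^1)-f^\star$, $\Delta_x=\frac1n\sum_i\|x_i^1-\bar x^1\|^2$, $\Delta_g=\frac1n\sum_i\big\|\nabla f_i(x_i^1)-\frac1n\sum_j\nabla f_j(x_j^1)\big\|^2$. **Claim.** Let $T\ge2$ and $\alpha=\min\{\sqrt n/\sqrt T,\;C\}$, where (with the convention that a bound whose denominator vanishes, because $\lambda=0$ or $\rho=0$, is $+\infty$) $$0<C\le\min\Big\{\tfrac{(1-\lambda^2)^2}{16\lambda^2L\sqrt3},\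 \tfrac{1-\lambda^2}{4\lambda L\sqrt[4]{12}},\ \tfrac{(1-\lambda^2)^{4/3}}{4\lambda^{4/3}L\sqrt[3]{12}},\ \tfrac{\sqrt[3]{n}\,(1-\lambda^2)^{4/3}}{\lambda^{4/3}\sigma_{\max}^{2/3}L^{2/3}\sqrt[3]{1614}},\ \tfrac1{4L},\ \tfrac{n}{9\sigma^2},\ \sqrt{\tfrac{n}{282e\,\sigma^2dL}},\ \tfrac{\sigma\sqrt{32}}{\rho},\ \Big(\tfrac{1}{16n\rho}\Big)^{\frac1{1+\varepsilon}}\Big\}.$$ Then for every $\delta\in(0,1)$, with probability at least $1-\delta$, $$\frac1{nT}\sum_{t=1}^T\sum_{i=1}^n\|\nabla f(x_i^t)\|^2\le K\bigg(\frac{\log(1/\delta)+\Delta_f+\sigma^2L(1+\log(2d))}{\sqrt{nT}}+\frac{n^{(3+\varepsilon)/2}\rho}{T^{(1+\varepsilon)/2}}+\frac{\log(1/\delta)+\Delta_f}{CT}+\frac{L^2\Delta_x}{(1-\lambda^2)T}+\frac{n\sigma^2\lambda^4L^2}{(1-\lambda^2)^4T}+\frac{nL^2\Delta_g}{(1-\lambda^2)^3T^2}\bigg).$$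 -/

import Mathlib

open MeasureTheory ProbabilityTheory
open scoped ENNReal

/-- The parameter space `ℝ^d` with the Euclidean norm. -/
abbrev Vec (d : ℕ) : Type := EuclideanSpace ℝ (Fin d)

/-- The arithmetic mean over the `n` agents. -/
noncomputable def agentMean {V : Type*} [AddCommGroup V] [Module ℝ V] {n : ℕ}
    (v : Fin n → V) : V :=
  (n : ℝ)⁻¹ • ∑ i, v i

/-- The global cost `f = (1/n) ∑ i, f_i`. -/
noncomputable def globalCost {n d : ℕ} (f : Fin n → Vec d → ℝ) (x : Vec d) : ℝ :=
  agentMean fun i => f i x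

/-- One communication round: agent `i` receives `∑ j, w_ij v_j`. -/
noncomputable def mix {n d : ℕ} (W : Matrix (Fin n) (Fin n) ℝ) (v : Fin n → Vec d) :
    Fin n → Vec d :=
  fun i => ∑ j, W i j • v j

/-- The ideal communication matrix `J = (1/n) 1 1ᵀ`. -/
noncomputable def idealMatrix (n : ℕ) : Matrix (Fin n) (Fin n) ℝ :=
  Matrix.of fun _ _ => (n : ℝ)⁻¹

/-- The network connectivity parameter `λ = ‖W - J‖` (the operator norm induced by the
Euclidean norm). -/
noncomputable def connectivity {n : ℕ} (W : Matrix (Fin n) (Fin n) ℝ) : ℝ :=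
  ‖Matrix.toEuclideanCLM (n := Fin n) (𝕜 := ℝ) (W - idealMatrix n)‖

/-- The variables of the method kept by the agents between two iterations. -/
structure GTState (n d : ℕ) where
  /-- local models -/
  x : Fin n → Vec d
  /-- gradient trackers -/
  y : Fin n → Vec d
  /-- last stochastic gradients -/
  g : Fin n → Vec d

/-- The method `GT-DSGD`. `gtState W α G x₁ s t` holds `x^{t+1}`, `y^t` and `g^t`, when
`s i t` is the random sample that the oracle `G i` of agent `i` uses in iteration `t ≥ 1`:
`g_i^t = G_i(x_i^t, s_i^t)`, `y_i^t = ∑ j, w_ij (y_j^{t-1} + g_j^t - g_j^{t-1})` and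
`x_i^{t+1} = ∑ j, w_ij (x_j^t - α_t y_j^t)`, from `y^0 = g^0 = 0`. -/
noncomputable def gtState {n d : ℕ} {Ξ : Fin n → Type*} (W : Matrix (Fin n) (Fin n) ℝ)
    (α : ℕ → ℝ) (G : ∀ i, Vec d → Ξ i → Vec d) (x₁ : Fin n → Vec d) (s : ∀ i, ℕ → Ξ i) :
    ℕ → GTState n d
  | 0 => ⟨x₁, 0, 0⟩
  | t + 1 =>
    let S := gtState W α G x₁ s t
    let g : Fin n → Vec d := fun i => G i (S.x i) (s i (t + 1))
    let y : Fin n → Vec d := mix W (S.y + g - S.g)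
    ⟨mix W (S.x - α (t + 1) • y), y, g⟩

section Run

variable {n d : ℕ} {Ω : Type*} {Ξ : Fin n → Type*} (W : Matrix (Fin n) (Fin n) ℝ) (α : ℕ → ℝ)
  (G : ∀ i, Vec d → Ξ i → Vec d) (x₁ : Fin n → Vec d) (ξ : ∀ i, ℕ → Ω → Ξ i)

/-- The model `x_i^t` of agent `i` at time `t ≥ 1`. -/
noncomputable def model (t : ℕ) (i : Fin n) (ω : Ω) : Vec d :=
  (gtState W α G x₁ (fun j s => ξ j s ω) (t - 1)).x i

/-- The stochastic gradient `g_i^t` of agent `i` at time `t ≥ 1`. -/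
noncomputable def stochGrad (t : ℕ) (i : Fin n) (ω : Ω) : Vec d :=
  (gtState W α G x₁ (fun j s => ξ j s ω) t).g i

/-- The stochastic noise `z_i^t = g_i^t - ∇f_i(x_i^t)`. -/
noncomputable def noise (f : Fin n → Vec d → ℝ) (t : ℕ) (i : Fin n) (ω : Ω) : Vec d :=
  stochGrad W α G x₁ ξ t i ω - gradient (f i) (model W α G x₁ ξ t i ω)

/-- The `σ`-algebra `F_t` generated by the models of all agents at the times `1, …, t`. -/
@[reducible] noncomputable def modelSigma (t : ℕ) : MeasurableSpace Ω :=
  ⨆ s ∈ Set.Icc 1 t, ⨆ i, MeasurableSpace.comap (model W α G x₁ ξ s i) inferInstance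

end Run

/-- The random vector `Z` is conditionally zero-mean given the `σ`-algebra `m`. -/
def CondZeroMean {Ω : Type*} [MeasurableSpace Ω] {d : ℕ} (μ : Measure Ω)
    (m : MeasurableSpace Ω) (Z : Ω → Vec d) : Prop :=
  Integrable Z μ ∧ condExp m μ Z =ᵐ[μ] 0

/-- The random vector `Z` is relaxed `(σ, ρ)`-sub-Gaussian given the `σ`-algebra `m`, with the
growth governed by the random vector `V` (which is `𝒯(X)` for some map `𝒯`): almost surely
`E[exp(‖Z‖² / σ²) | m] ≤ exp(1 + ρ ‖V‖)`. The conditional expectation is that of a nonnegative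
function, so no integrability is presupposed. -/
def RelaxedSubGaussian {Ω : Type*} [MeasurableSpace Ω] {d : ℕ} (μ : Measure Ω)
    (m : MeasurableSpace Ω) (Z V : Ω → Vec d) (σ ρ : ℝ) : Prop :=
  condLExp m μ (fun ω => ENNReal.ofReal (Real.exp (‖Z ω‖ ^ 2 / σ ^ 2))) ≤ᵐ[μ]
    fun ω => ENNReal.ofReal (Real.exp (1 + ρ * ‖V ω‖))

/-- The averaged noise parameter `σ² = (1/n) ∑ i, σ_i²`. -/
noncomputable def avgSq {n : ℕ} (σ : Fin n → ℝ) : ℝ :=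
  agentMean fun i => σ i ^ 2

/-- The maximal noise parameter `σ_max² = max_i σ_i²`. -/
noncomputable def maxSq {n : ℕ} (σ : Fin n → ℝ) : ℝ :=
  ⨆ i, σ i ^ 2

/-- The optimality gap `Δ_f = f(x̄^1) - inf f` at the initial average model. -/
noncomputable def deltaF {n d : ℕ} (f : Fin n → Vec d → ℝ) (x₁ : Fin n → Vec d) : ℝ :=
  globalCost f (agentMean x₁) - ⨅ x, globalCost f x

/-- The initial consensus gap `Δ_x = (1/n) ∑ i, ‖x_i^1 - x̄^1‖²`. -/
noncomputable def deltaX {n d : ℕ} (x₁ : Fin n → Vec d) : ℝ :=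
  agentMean fun i => ‖x₁ i - agentMean x₁‖ ^ 2

/-- The initial gradient heterogeneity
`Δ_g = (1/n) ∑ i, ‖∇f_i(x_i^1) - (1/n) ∑ j, ∇f_j(x_j^1)‖²`. -/
noncomputable def deltaG {n d : ℕ} (f : Fin n → Vec d → ℝ) (x₁ : Fin n → Vec d) : ℝ :=
  agentMean fun i =>
    ‖gradient (f i) (x₁ i) - agentMean fun j => gradient (f j) (x₁ j)‖ ^ 2

/-- `C` is at most the threshold for the step-size. Here `lam = λ`, `σsq = σ²` and
`σmaxsq = σ_max²`. The six bounds whose denominator contains `λ` or `ρ` are multiplied out, so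
that they are void (the threshold is `+∞`) for `λ = 0` and for `ρ = 0`. -/
structure StepThreshold (n d : ℕ) (lam L σsq σmaxsq ρ ε C : ℝ) : Prop where
  /-- `C ≤ (1-λ²)² / (16 λ² L √3)` -/
  consensus : C * (16 * lam ^ 2 * L * √3) ≤ (1 - lam ^ 2) ^ 2
  /-- `C ≤ (1-λ²) / (4 λ L 12^{1/4})` -/
  quarter : C * (4 * lam * L * (12 : ℝ) ^ (1 / 4 : ℝ)) ≤ 1 - lam ^ 2
  /-- `C ≤ (1-λ²)^{4/3} / (4 λ^{4/3} L 12^{1/3})` -/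
  third : C * (4 * lam ^ (4 / 3 : ℝ) * L * (12 : ℝ) ^ (1 / 3 : ℝ)) ≤ (1 - lam ^ 2) ^ (4 / 3 : ℝ)
  /-- `C ≤ n^{1/3} (1-λ²)^{4/3} / (λ^{4/3} σ_max^{2/3} L^{2/3} 1614^{1/3})` -/
  noiseMax : C * (lam ^ (4 / 3 : ℝ) * σmaxsq ^ (1 / 3 : ℝ) * L ^ (2 / 3 : ℝ) *
      (1614 : ℝ) ^ (1 / 3 : ℝ)) ≤ (n : ℝ) ^ (1 / 3 : ℝ) * (1 - lam ^ 2) ^ (4 / 3 : ℝ)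
  smooth : C ≤ 1 / (4 * L)
  noiseAvg : C ≤ n / (9 * σsq)
  dimension : C ≤ √(n / (282 * Real.exp 1 * σsq * d * L))
  /-- `C ≤ σ √32 / ρ` -/
  relaxed : C * ρ ≤ √σsq * √32
  /-- `C ≤ (1 / (16 n ρ))^{1/(1+ε)}` -/
  relaxedPow : C ^ (1 + ε) * (16 * n * ρ) ≤ 1

/-! The argument separates a pathwise estimate from a single exponential-moment estimate for the
noise.

Pathwise, mixing acts on deviations from the agents' mean as `W - J`, a contraction with factor λ.
The deviations of models and trackers therefore obey coupled linear recursions. Summed over time and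
closed under the consensus threshold, they bound the accumulated consensus error by the initial
gaps, by α² times squared mean gradients and mean noises, and by a multiple of the squared noises
(`sum_agentDev_x_le_of_threshold`). The mean model follows x̄ ↦ x̄ - α ḡ, so the descent lemma
telescopes, and its consensus term is absorbed (`sum_norm_sq_gradient_le`). What remains per
iteration is a linear form in the summed noise, the squared norm of that sum, and the individual
squared norms.

Probabilistically, subtracting a compensator from this remainder makes the exponential of its
running sum have expectation at most 1 (`lintegral_exp_sum_range_le`). Within an iteration the
independent noises are integrated out one agent at a time (`lintegral_exp_sum_noise_le`). The
squared norm of the sum then costs a multiple of ∑ σ_i², with neither an extra factor n nor a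
dimension factor. The assumptions given F_t are first turned into statements about oracles at a
frozen model, so they can be used under the larger history of samples. Markov's inequality bounds
the compensated sum by log(1/δ).

The compensator is paid for by the left side: its part quadratic in ∇f(x̄) by the descent term, and
its relaxed part ρ‖∇f(x_i)‖ by a fraction of the local squared gradients (`noise_arith`,
`sum_norm_sq_local_gradient_le`). Dividing by αT and using both bounds in α = min(√n/√T, C) gives
the rate (`rate_arith`). -/

/-! ### Exponential moments of a relaxed sub-Gaussian vector. -/

theorem exp_le_add_exp_sq (x : ℝ) : Real.exp x ≤ x + Real.exp (x ^ 2) := by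
  have hsq := Real.add_one_le_exp (x ^ 2)
  rcases le_or_gt |x| 1 with h | h
  · have := (abs_le.1 (Real.abs_exp_sub_one_sub_id_le h)).2
    linarith
  · rcases lt_abs.1 h with h | h
    · have : Real.exp x ≤ Real.exp (x ^ 2) := Real.exp_le_exp.2 (by nlinarith)
      linarith
    · have : Real.exp x ≤ 1 := Real.exp_le_one_iff.2 (by linarith)
      nlinarith

/-- Tangent line at `exp m` of the concave power with exponent `p`. Being affine in `exp y`, it can
be integrated termwise. -/
theorem exp_mul_le_of_mem_Icc {p : ℝ} (hp0 : 0 ≤ p) (hp1 : p ≤ 1) (y m : ℝ) :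
    Real.exp (p * y) ≤ Real.exp (p * m) * (p * Real.exp (-m)) * Real.exp y
      + Real.exp (p * m) * (1 - p) := by
  have h := convexOn_exp.2 (Set.mem_univ (y - m)) (Set.mem_univ 0) hp0 (sub_nonneg.2 hp1)
    (by ring)
  simp only [smul_eq_mul, mul_zero, add_zero, Real.exp_zero, mul_one] at h
  have e1 : Real.exp (p * y) = Real.exp (p * m) * Real.exp (p * (y - m)) := by
    rw [← Real.exp_add]; ring_nf
  have e2 : Real.exp (y - m) = Real.exp (-m) * Real.exp y := by
    rw [← Real.exp_add]; ring_nf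
  rw [e1]
  rw [e2] at h
  have := mul_le_mul_of_nonneg_left h (Real.exp_pos (p * m)).le
  linarith

section Moments

variable {Ω : Type*} [MeasurableSpace Ω] {μ : Measure Ω} [IsProbabilityMeasure μ]

/-- Jensen's inequality for a concave power, with the tangent point chosen so that the bound is
reproduced exactly. -/
theorem lintegral_exp_mul_le {Y : Ω → ℝ} {m p : ℝ} (hp0 : 0 ≤ p) (hp1 : p ≤ 1)
    (hY : AEMeasurable Y μ)
    (h : ∫⁻ ω, ENNReal.ofReal (Real.exp (Y ω)) ∂μ ≤ ENNReal.ofReal (Real.exp m)) :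
    ∫⁻ ω, ENNReal.ofReal (Real.exp (p * Y ω)) ∂μ ≤ ENNReal.ofReal (Real.exp (p * m)) := by
  have hq : 0 ≤ Real.exp (p * m) * (p * Real.exp (-m)) := by positivity
  have hr : 0 ≤ Real.exp (p * m) * (1 - p) :=
    mul_nonneg (Real.exp_pos _).le (sub_nonneg.2 hp1)
  calc ∫⁻ ω, ENNReal.ofReal (Real.exp (p * Y ω)) ∂μ
      ≤ ∫⁻ ω, (ENNReal.ofReal (Real.exp (p * m) * (p * Real.exp (-m))) *
          ENNReal.ofReal (Real.exp (Y ω)) + ENNReal.ofReal (Real.exp (p * m) * (1 - p))) ∂μ := by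
        refine lintegral_mono fun ω => ?_
        rw [← ENNReal.ofReal_mul hq, ← ENNReal.ofReal_add (by positivity) hr]
        exact ENNReal.ofReal_le_ofReal (exp_mul_le_of_mem_Icc hp0 hp1 _ _)
    _ = ENNReal.ofReal (Real.exp (p * m) * (p * Real.exp (-m))) *
          ∫⁻ ω, ENNReal.ofReal (Real.exp (Y ω)) ∂μ
          + ENNReal.ofReal (Real.exp (p * m) * (1 - p)) := by
        rw [lintegral_add_right _ measurable_const, lintegral_const_mul'' _ (by fun_prop)]
        simp
    _ ≤ ENNReal.ofReal (Real.exp (p * m) * (p * Real.exp (-m))) * ENNReal.ofReal (Real.exp m)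
          + ENNReal.ofReal (Real.exp (p * m) * (1 - p)) := by gcongr
    _ = ENNReal.ofReal (Real.exp (p * m)) := by
        rw [← ENNReal.ofReal_mul hq, ← ENNReal.ofReal_add (by positivity) hr]
        congr 1
        have : Real.exp (-m) * Real.exp m = 1 := by rw [← Real.exp_add]; simp
        linear_combination Real.exp (p * m) * p * this

variable {V : Type*} [NormedAddCommGroup V] [InnerProductSpace ℝ V] [CompleteSpace V]

theorem lintegral_exp_inner_le {Z : Ω → V} {s r : ℝ} (hs : 0 < s) (hr : 0 ≤ r)
    (hZ : Integrable Z μ) (hZ0 : ∫ ω, Z ω ∂μ = 0)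
    (h : ∫⁻ ω, ENNReal.ofReal (Real.exp (‖Z ω‖ ^ 2 / s ^ 2)) ∂μ ≤
      ENNReal.ofReal (Real.exp (1 + r))) (u : V) :
    ∫⁻ ω, ENNReal.ofReal (Real.exp (inner ℝ u (Z ω))) ∂μ ≤
      ENNReal.ofReal (Real.exp (‖u‖ ^ 2 * s ^ 2 + r)) := by
  have hX : AEMeasurable (fun ω => ‖Z ω‖ ^ 2 / s ^ 2) μ :=
    (hZ.aestronglyMeasurable.norm.aemeasurable.pow_const 2).div_const _
  have hin : ∀ ω, inner ℝ u (Z ω) ≤ ‖u‖ * ‖Z ω‖ := fun ω => real_inner_le_norm _ _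
  -- For small `u`, the inequality `exp x ≤ x + exp (x ^ 2)` lets the zero mean remove the linear
  -- term, and Jensen applies with exponent `‖u‖ ^ 2 * s ^ 2`. For large `u`, Young's inequality and
  -- exponent 1/2 suffice: the unused half of `‖u‖ ^ 2 * s ^ 2` exceeds the constant 1/2.
  rcases le_or_gt (‖u‖ ^ 2 * s ^ 2) 1 with hp | hp
  · have hp0 : 0 ≤ ‖u‖ ^ 2 * s ^ 2 := by positivity
    have hJ := lintegral_exp_mul_le hp0 hp hX h
    have hmeas : AEStronglyMeasurable
        (fun ω => Real.exp (‖u‖ ^ 2 * s ^ 2 * (‖Z ω‖ ^ 2 / s ^ 2))) μ :=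
      (Real.measurable_exp.comp_aemeasurable (hX.const_mul _)).aestronglyMeasurable
    have hint : Integrable (fun ω => Real.exp (‖u‖ ^ 2 * s ^ 2 * (‖Z ω‖ ^ 2 / s ^ 2))) μ := by
      refine ⟨hmeas, ?_⟩
      rw [hasFiniteIntegral_iff_ofReal (Filter.Eventually.of_forall fun _ => (Real.exp_pos _).le)]
      exact hJ.trans_lt ENNReal.ofReal_lt_top
    have hinner : Integrable (fun ω => inner ℝ u (Z ω)) μ := hZ.const_inner u
    have hpt : ∀ ω, Real.exp (inner ℝ u (Z ω)) ≤
        inner ℝ u (Z ω) + Real.exp (‖u‖ ^ 2 * s ^ 2 * (‖Z ω‖ ^ 2 / s ^ 2)) := by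
      intro ω
      refine (exp_le_add_exp_sq _).trans ?_
      have : inner ℝ u (Z ω) ^ 2 ≤ ‖u‖ ^ 2 * s ^ 2 * (‖Z ω‖ ^ 2 / s ^ 2) := by
        have e : ‖u‖ ^ 2 * s ^ 2 * (‖Z ω‖ ^ 2 / s ^ 2) = (‖u‖ * ‖Z ω‖) ^ 2 := by
          field_simp
        rw [e]
        exact sq_le_sq' (by linarith [neg_le_of_abs_le (abs_real_inner_le_norm u (Z ω))]) (hin ω)
      gcongr
    calc ∫⁻ ω, ENNReal.ofReal (Real.exp (inner ℝ u (Z ω))) ∂μ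
        ≤ ∫⁻ ω, ENNReal.ofReal (inner ℝ u (Z ω) +
            Real.exp (‖u‖ ^ 2 * s ^ 2 * (‖Z ω‖ ^ 2 / s ^ 2))) ∂μ :=
          lintegral_mono fun ω => ENNReal.ofReal_le_ofReal (hpt ω)
      _ = ENNReal.ofReal (∫ ω, (inner ℝ u (Z ω) +
            Real.exp (‖u‖ ^ 2 * s ^ 2 * (‖Z ω‖ ^ 2 / s ^ 2))) ∂μ) :=
          (ofReal_integral_eq_lintegral_ofReal (hinner.add hint)
            (Filter.Eventually.of_forall fun ω => (Real.exp_pos _).le.trans (hpt ω))).symm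
      _ = ENNReal.ofReal (∫ ω, Real.exp (‖u‖ ^ 2 * s ^ 2 * (‖Z ω‖ ^ 2 / s ^ 2)) ∂μ) := by
          rw [integral_add hinner hint, integral_inner hZ, hZ0, inner_zero_right, zero_add]
      _ = ∫⁻ ω, ENNReal.ofReal (Real.exp (‖u‖ ^ 2 * s ^ 2 * (‖Z ω‖ ^ 2 / s ^ 2))) ∂μ :=
          ofReal_integral_eq_lintegral_ofReal hint
            (Filter.Eventually.of_forall fun ω => (Real.exp_pos _).le)
      _ ≤ _ := hJ
      _ ≤ _ := ENNReal.ofReal_le_ofReal (Real.exp_le_exp.2 (by nlinarith))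
  · have hJ := lintegral_exp_mul_le (p := 1 / 2) (by norm_num) (by norm_num) hX h
    calc ∫⁻ ω, ENNReal.ofReal (Real.exp (inner ℝ u (Z ω))) ∂μ
        ≤ ∫⁻ ω, ENNReal.ofReal (Real.exp (‖u‖ ^ 2 * s ^ 2 / 2)) *
            ENNReal.ofReal (Real.exp (1 / 2 * (‖Z ω‖ ^ 2 / s ^ 2))) ∂μ := by
          refine lintegral_mono fun ω => ?_
          rw [← ENNReal.ofReal_mul (Real.exp_pos _).le, ← Real.exp_add]
          refine ENNReal.ofReal_le_ofReal (Real.exp_le_exp.2 ((hin ω).trans ?_))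
          have e : ‖u‖ * ‖Z ω‖ = (‖u‖ * s) * (‖Z ω‖ / s) := by field_simp
          have e' : ‖Z ω‖ ^ 2 / s ^ 2 = (‖Z ω‖ / s) ^ 2 := by rw [div_pow]
          rw [e, e', ← mul_pow]
          nlinarith [sq_nonneg (‖u‖ * s - ‖Z ω‖ / s)]
      _ = ENNReal.ofReal (Real.exp (‖u‖ ^ 2 * s ^ 2 / 2)) *
            ∫⁻ ω, ENNReal.ofReal (Real.exp (1 / 2 * (‖Z ω‖ ^ 2 / s ^ 2))) ∂μ :=
          lintegral_const_mul'' _ (by fun_prop)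
      _ ≤ ENNReal.ofReal (Real.exp (‖u‖ ^ 2 * s ^ 2 / 2)) *
            ENNReal.ofReal (Real.exp (1 / 2 * (1 + r))) := by gcongr
      _ ≤ _ := by
          rw [← ENNReal.ofReal_mul (Real.exp_pos _).le, ← Real.exp_add]
          exact ENNReal.ofReal_le_ofReal (Real.exp_le_exp.2 (by linarith))

/-- Cauchy–Schwarz splits the exponential into its linear and quadratic parts, each with doubled
exponent. The square root halves `r` in the linear part, and `2 * b * s ^ 2 ≤ 1` limits the
quadratic part to another half, so `r` enters only once. -/
theorem lintegral_exp_inner_add_norm_sq_le {Z : Ω → V} {s r : ℝ} (hs : 0 < s) (hr : 0 ≤ r)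
    (hZ : Integrable Z μ) (hZ0 : ∫ ω, Z ω ∂μ = 0)
    (h : ∫⁻ ω, ENNReal.ofReal (Real.exp (‖Z ω‖ ^ 2 / s ^ 2)) ∂μ ≤
      ENNReal.ofReal (Real.exp (1 + r))) {b : ℝ} (hb : 0 ≤ b) (hb1 : 2 * b * s ^ 2 ≤ 1) (v : V) :
    ∫⁻ ω, ENNReal.ofReal (Real.exp (inner ℝ v (Z ω) + b * ‖Z ω‖ ^ 2)) ∂μ ≤
      ENNReal.ofReal (Real.exp (2 * ‖v‖ ^ 2 * s ^ 2 + b * s ^ 2 + r)) := by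
  have hX : AEMeasurable (fun ω => ‖Z ω‖ ^ 2 / s ^ 2) μ :=
    (hZ.aestronglyMeasurable.norm.aemeasurable.pow_const 2).div_const _
  have h1 := lintegral_exp_inner_le hs hr hZ hZ0 h ((2 : ℝ) • v)
  have h2 := lintegral_exp_mul_le (by positivity) hb1 hX h
  set A := ‖(2 : ℝ) • v‖ ^ 2 * s ^ 2 + r with hA
  set B := 2 * b * s ^ 2 * (1 + r) with hB
  have hA' : A = 4 * ‖v‖ ^ 2 * s ^ 2 + r := by
    rw [hA, norm_smul, mul_pow]; norm_num
  have hinm : AEMeasurable (fun ω => inner ℝ ((2 : ℝ) • v) (Z ω)) μ :=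
    (hZ.const_inner _).aestronglyMeasurable.aemeasurable
  -- The geometric mean of the two moment bounds: Cauchy–Schwarz is carried out as a pointwise AM–GM
  -- between factors normalised by these bounds.
  set c := Real.exp ((A + B) / 2) with hc
  calc ∫⁻ ω, ENNReal.ofReal (Real.exp (inner ℝ v (Z ω) + b * ‖Z ω‖ ^ 2)) ∂μ
      ≤ ∫⁻ ω, (ENNReal.ofReal (c * Real.exp (-A) / 2) *
            ENNReal.ofReal (Real.exp (inner ℝ ((2 : ℝ) • v) (Z ω)))
          + ENNReal.ofReal (c * Real.exp (-B) / 2) *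
            ENNReal.ofReal (Real.exp (2 * b * s ^ 2 * (‖Z ω‖ ^ 2 / s ^ 2)))) ∂μ := by
        refine lintegral_mono fun ω => ?_
        rw [← ENNReal.ofReal_mul (by positivity), ← ENNReal.ofReal_mul (by positivity),
          ← ENNReal.ofReal_add (by positivity) (by positivity)]
        refine ENNReal.ofReal_le_ofReal ?_
        have e : 2 * b * s ^ 2 * (‖Z ω‖ ^ 2 / s ^ 2) = 2 * (b * ‖Z ω‖ ^ 2) := by field_simp
        rw [e, real_inner_smul_left]
        set x := inner ℝ v (Z ω)
        set y := b * ‖Z ω‖ ^ 2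
        have e0 : ∀ a w : ℝ, c * Real.exp (-a) / 2 * Real.exp (2 * w) =
            c * (Real.exp (w - a / 2)) ^ 2 / 2 := by
          intro a w
          have : Real.exp (w - a / 2) ^ 2 = Real.exp (-a) * Real.exp (2 * w) := by
            rw [← Real.exp_nat_mul, ← Real.exp_add]
            push_cast; ring_nf
          rw [this]; ring
        have e3 : Real.exp (x + y) = c * (Real.exp (x - A / 2) * Real.exp (y - B / 2)) := by
          rw [hc, ← Real.exp_add, ← Real.exp_add]; ring_nf
        rw [e0, e0, e3]
        have hc0 : 0 < c := Real.exp_pos _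
        nlinarith [mul_nonneg hc0.le (sq_nonneg (Real.exp (x - A / 2) - Real.exp (y - B / 2)))]
    _ = ENNReal.ofReal (c * Real.exp (-A) / 2) *
            ∫⁻ ω, ENNReal.ofReal (Real.exp (inner ℝ ((2 : ℝ) • v) (Z ω))) ∂μ
          + ENNReal.ofReal (c * Real.exp (-B) / 2) *
            ∫⁻ ω, ENNReal.ofReal (Real.exp (2 * b * s ^ 2 * (‖Z ω‖ ^ 2 / s ^ 2))) ∂μ := by
        rw [lintegral_add_left' (by fun_prop), lintegral_const_mul'' _ (by fun_prop),
          lintegral_const_mul'' _ (by fun_prop)]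
    _ ≤ ENNReal.ofReal (c * Real.exp (-A) / 2) * ENNReal.ofReal (Real.exp A)
          + ENNReal.ofReal (c * Real.exp (-B) / 2) * ENNReal.ofReal (Real.exp B) := by
        gcongr
    _ = ENNReal.ofReal c := by
        rw [← ENNReal.ofReal_mul (by positivity), ← ENNReal.ofReal_mul (by positivity),
          ← ENNReal.ofReal_add (by positivity) (by positivity)]
        congr 1
        have hA1 : Real.exp (-A) * Real.exp A = 1 := by rw [← Real.exp_add]; simp
        have hB1 : Real.exp (-B) * Real.exp B = 1 := by rw [← Real.exp_add]; simp
        linear_combination c / 2 * hA1 + c / 2 * hB1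
    _ ≤ _ := by
        refine ENNReal.ofReal_le_ofReal (Real.exp_le_exp.2 ?_)
        rw [hA', hB]
        nlinarith

end Moments

/-! ### Mean and deviation across the agents. -/

section AgentMean

/-- The deviation of the agents' vectors from their mean. -/
noncomputable def agentDev {n d : ℕ} (v : Fin n → Vec d) (i : Fin n) : Vec d :=
  v i - agentMean v

variable {n d : ℕ}

theorem agentMean_add (v w : Fin n → Vec d) : agentMean (v + w) = agentMean v + agentMean w := by
  simp [agentMean, Finset.sum_add_distrib]

theorem agentMean_sub (v w : Fin n → Vec d) : agentMean (v - w) = agentMean v - agentMean w := by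
  simp [agentMean, Finset.sum_sub_distrib, smul_sub]

theorem agentMean_smul (c : ℝ) (v : Fin n → Vec d) : agentMean (c • v) = c • agentMean v := by
  simp [agentMean, ← Finset.smul_sum, smul_comm c]

theorem agentDev_add (v w : Fin n → Vec d) : agentDev (v + w) = agentDev v + agentDev w := by
  ext1 i; simp only [agentDev, agentMean_add, Pi.add_apply]; abel

theorem agentDev_sub (v w : Fin n → Vec d) : agentDev (v - w) = agentDev v - agentDev w := by
  ext1 i; simp only [agentDev, agentMean_sub, Pi.sub_apply]; abel

theorem agentDev_smul (c : ℝ) (v : Fin n → Vec d) : agentDev (c • v) = c • agentDev v := by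
  ext1 i; simp only [agentDev, agentMean_smul, Pi.smul_apply, smul_sub]

theorem sum_eq_smul_agentMean (hn : 0 < n) (v : Fin n → Vec d) :
    ∑ i, v i = (n : ℝ) • agentMean v := by
  have : (n : ℝ) ≠ 0 := by positivity
  rw [agentMean, smul_smul, mul_inv_cancel₀ this, one_smul]

theorem sum_agentDev (hn : 0 < n) (v : Fin n → Vec d) : ∑ i, agentDev v i = 0 := by
  simp only [agentDev, Finset.sum_sub_distrib, Finset.sum_const, Finset.card_univ,
    Fintype.card_fin]
  rw [sum_eq_smul_agentMean hn, Nat.cast_smul_eq_nsmul, sub_self]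

theorem sum_norm_sq_eq_agentDev_add (hn : 0 < n) (v : Fin n → Vec d) :
    ∑ i, ‖v i‖ ^ 2 = ∑ i, ‖agentDev v i‖ ^ 2 + n * ‖agentMean v‖ ^ 2 := by
  have h : ∀ i, ‖v i‖ ^ 2 =
      ‖agentDev v i‖ ^ 2 + 2 * inner ℝ (agentDev v i) (agentMean v) + ‖agentMean v‖ ^ 2 := by
    intro i
    rw [← norm_add_sq_real, agentDev, sub_add_cancel]
  rw [Finset.sum_congr rfl fun i _ => h i, Finset.sum_add_distrib, Finset.sum_add_distrib,
    ← Finset.mul_sum, ← sum_inner, sum_agentDev hn]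
  simp

theorem sum_norm_sq_agentDev_le (hn : 0 < n) (v : Fin n → Vec d) :
    ∑ i, ‖agentDev v i‖ ^ 2 ≤ ∑ i, ‖v i‖ ^ 2 := by
  rw [sum_norm_sq_eq_agentDev_add hn v]
  have : 0 ≤ (n : ℝ) * ‖agentMean v‖ ^ 2 := by positivity
  linarith

theorem mul_norm_sq_agentMean_le (hn : 0 < n) (v : Fin n → Vec d) :
    n * ‖agentMean v‖ ^ 2 ≤ ∑ i, ‖v i‖ ^ 2 := by
  rw [sum_norm_sq_eq_agentDev_add hn v]
  have : 0 ≤ ∑ i, ‖agentDev v i‖ ^ 2 := by positivity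
  linarith

theorem norm_add_sq_le_two_mul {V : Type*} [SeminormedAddCommGroup V] (a b : V) :
    ‖a + b‖ ^ 2 ≤ 2 * ‖a‖ ^ 2 + 2 * ‖b‖ ^ 2 := by
  have := norm_add_le a b
  have h0 := norm_nonneg (a + b)
  nlinarith [sq_nonneg (‖a‖ - ‖b‖)]

theorem norm_sub_sq_le_two_mul {V : Type*} [SeminormedAddCommGroup V] (a b : V) :
    ‖a - b‖ ^ 2 ≤ 2 * ‖a‖ ^ 2 + 2 * ‖b‖ ^ 2 := by
  simpa [sub_eq_add_neg] using norm_add_sq_le_two_mul a (-b)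

end AgentMean

/-! ### Contraction of deviations by mixing. -/

section Mix

variable {n d : ℕ} {W : Matrix (Fin n) (Fin n) ℝ}

theorem agentMean_mix (hW : W ∈ doublyStochastic ℝ (Fin n)) (v : Fin n → Vec d) :
    agentMean (mix W v) = agentMean v := by
  simp only [agentMean, mix]
  rw [Finset.sum_comm]
  simp_rw [← Finset.sum_smul, sum_col_of_mem_doublyStochastic hW, one_smul]

/-- Deviations sum to zero, so `J` annihilates them and may be subtracted from `W`. Working per
coordinate reduces the vector case to the operator norm on `ℝ^n`. -/
theorem agentDev_mix_apply (hn : 0 < n) (hW : W ∈ doublyStochastic ℝ (Fin n))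
    (v : Fin n → Vec d) (i : Fin n) (k : Fin d) :
    agentDev (mix W v) i k =
      ((W - idealMatrix n).mulVec fun j => agentDev v j k) i := by
  have h0 : ∑ j, agentDev v j k = 0 := by
    have := congrArg (fun w : Vec d => w k) (sum_agentDev hn v)
    simpa using this
  have h1 : ∑ j, W i j * agentMean v k = agentMean v k := by
    rw [← Finset.sum_mul, sum_row_of_mem_doublyStochastic hW, one_mul]
  rw [agentDev, agentMean_mix hW]
  simp only [Matrix.mulVec, dotProduct, Matrix.sub_apply, idealMatrix, Matrix.of_apply, sub_mul,
    Finset.sum_sub_distrib, ← Finset.mul_sum, h0, mul_zero, sub_zero]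
  simp only [agentDev, mix, PiLp.sub_apply, mul_sub, Finset.sum_sub_distrib, h1]
  simp

theorem sum_norm_sq_agentDev_mix_le (hn : 0 < n) (hW : W ∈ doublyStochastic ℝ (Fin n))
    (v : Fin n → Vec d) :
    ∑ i, ‖agentDev (mix W v) i‖ ^ 2 ≤ connectivity W ^ 2 * ∑ i, ‖agentDev v i‖ ^ 2 := by
  simp only [EuclideanSpace.real_norm_sq_eq]
  rw [Finset.sum_comm, Finset.sum_comm (f := fun i k => agentDev v i k ^ 2), Finset.mul_sum]
  refine Finset.sum_le_sum fun k _ => ?_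
  have h := (Matrix.toEuclideanCLM (n := Fin n) (𝕜 := ℝ) (W - idealMatrix n)).le_opNorm
    (WithLp.toLp 2 fun j => agentDev v j k)
  have h2 := pow_le_pow_left₀ (norm_nonneg _) h 2
  rw [mul_pow, Matrix.toEuclideanCLM_toLp, EuclideanSpace.real_norm_sq_eq,
    EuclideanSpace.real_norm_sq_eq] at h2
  simp only [agentDev_mix_apply hn hW]
  exact h2

/-- Young's inequality, weighted so that the contraction factor is the midpoint of `l ^ 2` and 1.
Nothing is divided by `l`, so `l = 0` needs no separate case. -/
theorem sq_mul_norm_sub_sq_le {V : Type*} [SeminormedAddCommGroup V] {l : ℝ} (hl : l ^ 2 < 1)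
    (a b : V) : l ^ 2 * ‖a - b‖ ^ 2 ≤
      (1 + l ^ 2) / 2 * ‖a‖ ^ 2 + 2 * l ^ 2 / (1 - l ^ 2) * ‖b‖ ^ 2 := by
  have hm : 0 < 1 - l ^ 2 := by linarith
  have h1 : ‖a - b‖ ^ 2 ≤ (‖a‖ + ‖b‖) ^ 2 :=
    pow_le_pow_left₀ (norm_nonneg _) (norm_sub_le a b) 2
  have h2 : l ^ 2 * ‖a - b‖ ^ 2 ≤ l ^ 2 * (‖a‖ + ‖b‖) ^ 2 := by gcongr
  refine h2.trans ?_
  set p := ‖a‖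
  set q := ‖b‖
  have e : (1 + l ^ 2) / 2 * p ^ 2 + 2 * l ^ 2 / (1 - l ^ 2) * q ^ 2 - l ^ 2 * (p + q) ^ 2 =
      (((1 - l ^ 2) * p - 2 * l ^ 2 * q) ^ 2 + 2 * l ^ 2 * (1 - l ^ 2) * q ^ 2)
        / (2 * (1 - l ^ 2)) := by
    field_simp; ring
  have : 0 ≤ (((1 - l ^ 2) * p - 2 * l ^ 2 * q) ^ 2 + 2 * l ^ 2 * (1 - l ^ 2) * q ^ 2)
        / (2 * (1 - l ^ 2)) := by positivity
  linarith

theorem sum_norm_sq_agentDev_mix_sub_le (hn : 0 < n) (hW : W ∈ doublyStochastic ℝ (Fin n))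
    (hl : connectivity W ^ 2 < 1) (v w : Fin n → Vec d) :
    ∑ i, ‖agentDev (mix W (v - w)) i‖ ^ 2 ≤
      (1 + connectivity W ^ 2) / 2 * ∑ i, ‖agentDev v i‖ ^ 2
        + 2 * connectivity W ^ 2 / (1 - connectivity W ^ 2) * ∑ i, ‖agentDev w i‖ ^ 2 := by
  refine (sum_norm_sq_agentDev_mix_le hn hW _).trans ?_
  rw [Finset.mul_sum, Finset.mul_sum, Finset.mul_sum, ← Finset.sum_add_distrib]
  refine Finset.sum_le_sum fun i _ => ?_
  rw [agentDev_sub]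
  exact sq_mul_norm_sub_sq_le hl _ _

end Mix

theorem sum_range_succ_le_of_contraction {a b : ℕ → ℝ} {q c : ℝ} (hq0 : 0 ≤ q) (hq : q < 1)
    (ha : ∀ t, 0 ≤ a t) (h : ∀ t, a (t + 1) ≤ q * a t + c * b t) (m : ℕ) :
    ∑ t ∈ Finset.range (m + 1), a t ≤
      (1 - q)⁻¹ * (a 0 + c * ∑ t ∈ Finset.range m, b t) := by
  -- Keeping the last term `a m` makes the induction close; it also extends the final sum by one
  -- index without a further `b`.
  have key : ∀ m, (1 - q) * ∑ t ∈ Finset.range m, a t + a m ≤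
      a 0 + c * ∑ t ∈ Finset.range m, b t := by
    intro m
    induction m with
    | zero => simp
    | succ m ih =>
      rw [Finset.sum_range_succ, Finset.sum_range_succ, mul_add, mul_add]
      linarith [h m]
  have hq' : 0 < 1 - q := by linarith
  rw [← div_eq_inv_mul, le_div_iff₀ hq', mul_comm]
  rw [Finset.sum_range_succ, mul_add]
  nlinarith [key m, ha m]

/-! ### Smoothness of the local and global costs. -/

section Smooth

variable {n d : ℕ}

theorem descent_lemma {V : Type*} [NormedAddCommGroup V] [InnerProductSpace ℝ V] [CompleteSpace V]
    {f : V → ℝ} {L : ℝ} (hf : Differentiable ℝ f)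
    (hL : ∀ x y, ‖gradient f x - gradient f y‖ ≤ L * ‖x - y‖) (x v : V) :
    f (x + v) ≤ f x + inner ℝ (gradient f x) v + L / 2 * ‖v‖ ^ 2 := by
  have hd : ∀ s : ℝ, HasDerivAt
      (fun s : ℝ => f (x + s • v) - s * inner ℝ (gradient f x) v - L / 2 * ‖v‖ ^ 2 * s ^ 2)
      (inner ℝ (gradient f (x + s • v)) v - inner ℝ (gradient f x) v - L * ‖v‖ ^ 2 * s) s := by
    intro s
    have h1 : HasDerivAt (fun s : ℝ => x + s • v) v s := by
      simpa using ((hasDerivAt_id s).smul_const v).const_add x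
    have h2 := ((hf (x + s • v)).hasGradientAt.hasFDerivAt).comp_hasDerivAt s h1
    have h3 := (h2.sub ((hasDerivAt_id s).mul_const (inner ℝ (gradient f x) v))).sub
      ((hasDerivAt_pow 2 s).const_mul (L / 2 * ‖v‖ ^ 2))
    refine h3.congr_deriv ?_
    simp only [InnerProductSpace.toDual_apply_apply]
    push_cast
    ring
  -- Compensated by its first-order term and the quadratic, `f` decreases along the segment, because
  -- the Lipschitz bound makes the derivative nonpositive. Comparing the endpoints is the claim.
  have hanti : AntitoneOn
      (fun s : ℝ => f (x + s • v) - s * inner ℝ (gradient f x) v - L / 2 * ‖v‖ ^ 2 * s ^ 2)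
      (Set.Icc 0 1) := by
    refine antitoneOn_of_deriv_nonpos (convex_Icc 0 1)
      (fun s _ => (hd s).continuousAt.continuousWithinAt)
      (fun s _ => (hd s).differentiableAt.differentiableWithinAt) fun s hs => ?_
    rw [interior_Icc] at hs
    rw [(hd s).deriv, ← inner_sub_left]
    have h1 := real_inner_le_norm (gradient f (x + s • v) - gradient f x) v
    have h2 := hL (x + s • v) x
    rw [add_sub_cancel_left, norm_smul, Real.norm_of_nonneg hs.1.le] at h2
    nlinarith [norm_nonneg v, mul_le_mul_of_nonneg_right h2 (norm_nonneg v)]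
  have := hanti (Set.left_mem_Icc.2 zero_le_one) (Set.right_mem_Icc.2 zero_le_one) zero_le_one
  simp only [one_smul, zero_smul, add_zero, one_mul, zero_mul, one_pow, mul_one, sub_zero,
    ne_eq, OfNat.ofNat_ne_zero, not_false_eq_true, zero_pow, mul_zero] at this
  linarith

theorem gradient_globalCost {f : Fin n → Vec d → ℝ} (hf : ∀ i, Differentiable ℝ (f i))
    (x : Vec d) : gradient (globalCost f) x = agentMean fun i => gradient (f i) x := by
  have h : HasFDerivAt (globalCost f) ((n : ℝ)⁻¹ • ∑ i, fderiv ℝ (f i) x) x := by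
    have := (HasFDerivAt.sum fun i (_ : i ∈ Finset.univ) => (hf i x).hasFDerivAt).const_smul
      ((n : ℝ)⁻¹)
    refine this.congr_of_eventuallyEq (Filter.Eventually.of_forall fun y => ?_)
    simp [globalCost, agentMean]
  rw [gradient, h.fderiv]
  simp [agentMean, gradient]

theorem differentiable_globalCost {f : Fin n → Vec d → ℝ} (hf : ∀ i, Differentiable ℝ (f i)) :
    Differentiable ℝ (globalCost f) := by
  have : globalCost f = fun x => (n : ℝ)⁻¹ * ∑ i, f i x := by
    ext x; simp [globalCost, agentMean]
  rw [this]
  exact (Differentiable.fun_sum fun i _ => hf i).const_mul _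

theorem norm_agentMean_le (v : Fin n → Vec d) : ‖agentMean v‖ ≤ (n : ℝ)⁻¹ * ∑ i, ‖v i‖ := by
  rw [agentMean, norm_smul, norm_inv, Real.norm_natCast]
  gcongr
  exact norm_sum_le _ _

theorem norm_gradient_globalCost_sub_le (hn : 0 < n) {f : Fin n → Vec d → ℝ} {L : ℝ}
    (hf : ∀ i, Differentiable ℝ (f i))
    (hL : ∀ i x y, ‖gradient (f i) x - gradient (f i) y‖ ≤ L * ‖x - y‖) (x y : Vec d) :
    ‖gradient (globalCost f) x - gradient (globalCost f) y‖ ≤ L * ‖x - y‖ := by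
  have hn' : (n : ℝ) ≠ 0 := by positivity
  rw [gradient_globalCost hf, gradient_globalCost hf, ← agentMean_sub]
  refine (norm_agentMean_le _).trans ?_
  calc (n : ℝ)⁻¹ * ∑ i, ‖gradient (f i) x - gradient (f i) y‖
      ≤ (n : ℝ)⁻¹ * ∑ _i : Fin n, L * ‖x - y‖ := by
        gcongr; exact hL _ _ _
    _ = L * ‖x - y‖ := by simp [hn']

end Smooth

/-! ### Pathwise analysis of gradient tracking. -/

/-- The estimates form a loop: models depend on trackers, trackers on gradient increments,
increments on models. Going round once returns `SX` with coefficient `128 * (P * L ^ 2)`, which the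
threshold `768 * (P * L ^ 2) ≤ 1` makes at most 1/6; moving it to the left leaves 5/6. -/
theorem consensus_arith {l α L N SX SH SB SZ SY SY' SG G0 Z0 DX DG : ℝ} (hl : l ^ 2 < 1)
    (hN : 0 ≤ N) (hSX : 0 ≤ SX) (hSHB : 0 ≤ SH + SB) (hSZ : 0 ≤ SZ)
    (hα : 768 * α ^ 2 * L ^ 2 * l ^ 4 ≤ (1 - l ^ 2) ^ 4)
    (hxs : SX ≤ 2 / (1 - l ^ 2) * (DX + 2 * l ^ 2 / (1 - l ^ 2) * α ^ 2 * SY'))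
    (hylast : SY' ≤ SY)
    (hys : SY ≤ 2 / (1 - l ^ 2) * (l ^ 2 * G0 + 2 * l ^ 2 / (1 - l ^ 2) * SG))
    (hgs : SG ≤ 8 * L ^ 2 * SX + 4 * L ^ 2 * N * α ^ 2 * SH + 4 * L ^ 2 * N * α ^ 2 * SB + 8 * SZ)
    (hg0 : G0 ≤ 2 * DG + 2 * Z0) (hz0 : Z0 ≤ SZ) :
    5 / 6 * SX ≤ 2 * DX / (1 - l ^ 2) + 16 * α ^ 2 * l ^ 4 * DG / (1 - l ^ 2) ^ 3
      + 1 / 12 * N * α ^ 2 * (SH + SB) + 144 * (α ^ 2 * l ^ 4 / (1 - l ^ 2) ^ 4) * SZ := by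
  have hm : 0 < 1 - l ^ 2 := by linarith
  have hm1 : 1 - l ^ 2 ≤ 1 := by linarith [sq_nonneg l]
  set u := 1 - l ^ 2 with hu
  set P := α ^ 2 * l ^ 4 / u ^ 4 with hP
  have hP0 : 0 ≤ P := by positivity
  have hPL : 768 * (P * L ^ 2) ≤ 1 := by
    rw [hP]
    have : 768 * (α ^ 2 * l ^ 4 / u ^ 4 * L ^ 2) = (768 * α ^ 2 * L ^ 2 * l ^ 4) / u ^ 4 := by ring
    rw [this, div_le_one (by positivity)]
    exact hα
  have h1 : SX ≤ 2 / u * (DX + 2 * l ^ 2 / u * α ^ 2 *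
      (2 / u * (l ^ 2 * (2 * DG + 2 * SZ) + 2 * l ^ 2 / u * SG))) := by
    refine hxs.trans ?_
    gcongr
    refine hylast.trans (hys.trans ?_)
    gcongr
    linarith
  have h2 : 2 / u * (DX + 2 * l ^ 2 / u * α ^ 2 *
      (2 / u * (l ^ 2 * (2 * DG + 2 * SZ) + 2 * l ^ 2 / u * SG))) =
      2 * DX / u + 16 * α ^ 2 * l ^ 4 * DG / u ^ 3 + 16 * P * u * SZ + 16 * P * SG := by
    rw [hP]; field_simp; ring
  rw [h2] at h1
  have h3 : 16 * P * u * SZ ≤ 16 * P * SZ := by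
    have : 0 ≤ P * SZ := by positivity
    nlinarith
  have h4 : 16 * P * SG ≤ 16 * P * (8 * L ^ 2 * SX + 4 * L ^ 2 * N * α ^ 2 * SH
      + 4 * L ^ 2 * N * α ^ 2 * SB + 8 * SZ) := by gcongr
  have h5 : 128 * (P * L ^ 2) * SX ≤ 1 / 6 * SX := by nlinarith
  have h6 : 64 * (P * L ^ 2) * (N * α ^ 2 * (SH + SB)) ≤ 1 / 12 * (N * α ^ 2 * (SH + SB)) := by
    have : 0 ≤ N * α ^ 2 * (SH + SB) := by positivity
    nlinarith
  linarith

/-- The recursion of gradient tracking with constant step-size `α`, for the models `x`, trackers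
`y` and stochastic gradients `g`, all numbered from `0`. -/
structure IsGTRun {n d : ℕ} (W : Matrix (Fin n) (Fin n) ℝ) (α : ℝ)
    (x y g : ℕ → Fin n → Vec d) : Prop where
  y_zero : y 0 = mix W (g 0)
  y_succ : ∀ t, y (t + 1) = mix W (y t - (g t - g (t + 1)))
  x_succ : ∀ t, x (t + 1) = mix W (x t - α • y t)

namespace IsGTRun

variable {n d : ℕ} {W : Matrix (Fin n) (Fin n) ℝ} {α : ℝ} {x y g : ℕ → Fin n → Vec d}

/-- The tracking property: mixing preserves means and the increments of `g` telescope. It makes the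
mean model follow stochastic gradient descent exactly. -/
theorem agentMean_y (h : IsGTRun W α x y g) (hW : W ∈ doublyStochastic ℝ (Fin n)) (t : ℕ) :
    agentMean (y t) = agentMean (g t) := by
  induction t with
  | zero => rw [h.y_zero, agentMean_mix hW]
  | succ t ih =>
    rw [h.y_succ, agentMean_mix hW, agentMean_sub, agentMean_sub, ih]
    abel

theorem agentMean_x_succ (h : IsGTRun W α x y g) (hW : W ∈ doublyStochastic ℝ (Fin n)) (t : ℕ) :
    agentMean (x (t + 1)) = agentMean (x t) - α • agentMean (g t) := by
  rw [h.x_succ, agentMean_mix hW, agentMean_sub, agentMean_smul, h.agentMean_y hW]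

theorem sum_agentDev_x_le (h : IsGTRun W α x y g) (hn : 0 < n)
    (hW : W ∈ doublyStochastic ℝ (Fin n)) (hl : connectivity W ^ 2 < 1) (m : ℕ) :
    ∑ t ∈ Finset.range (m + 1), ∑ i, ‖agentDev (x t) i‖ ^ 2 ≤
      2 / (1 - connectivity W ^ 2) * (∑ i, ‖agentDev (x 0) i‖ ^ 2
        + 2 * connectivity W ^ 2 / (1 - connectivity W ^ 2) * α ^ 2 *
          ∑ t ∈ Finset.range m, ∑ i, ‖agentDev (y t) i‖ ^ 2) := by
  have hq : (2 : ℝ) / (1 - connectivity W ^ 2) = (1 - (1 + connectivity W ^ 2) / 2)⁻¹ := by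
    rw [show 1 - (1 + connectivity W ^ 2) / 2 = (1 - connectivity W ^ 2) / 2 by ring, inv_div]
  rw [hq]
  refine sum_range_succ_le_of_contraction (by positivity) (by linarith)
    (fun t => by positivity) (fun t => ?_) m
  rw [h.x_succ]
  refine (sum_norm_sq_agentDev_mix_sub_le hn hW hl _ _).trans_eq ?_
  simp only [agentDev_smul, Pi.smul_apply, norm_smul, mul_pow, ← Finset.mul_sum, Real.norm_eq_abs,
    sq_abs]
  ring

theorem sum_agentDev_y_le (h : IsGTRun W α x y g) (hn : 0 < n)
    (hW : W ∈ doublyStochastic ℝ (Fin n)) (hl : connectivity W ^ 2 < 1) (m : ℕ) :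
    ∑ t ∈ Finset.range (m + 1), ∑ i, ‖agentDev (y t) i‖ ^ 2 ≤
      2 / (1 - connectivity W ^ 2) * (connectivity W ^ 2 * ∑ i, ‖agentDev (g 0) i‖ ^ 2
        + 2 * connectivity W ^ 2 / (1 - connectivity W ^ 2) *
          ∑ t ∈ Finset.range m, ∑ i, ‖g (t + 1) i - g t i‖ ^ 2) := by
  have hm : 0 < 1 - connectivity W ^ 2 := by linarith
  have hq : (2 : ℝ) / (1 - connectivity W ^ 2) = (1 - (1 + connectivity W ^ 2) / 2)⁻¹ := by
    rw [show 1 - (1 + connectivity W ^ 2) / 2 = (1 - connectivity W ^ 2) / 2 by ring, inv_div]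
  have h0 : ∑ i, ‖agentDev (y 0) i‖ ^ 2 ≤ connectivity W ^ 2 * ∑ i, ‖agentDev (g 0) i‖ ^ 2 := by
    rw [h.y_zero]
    exact sum_norm_sq_agentDev_mix_le hn hW _
  have h1 := sum_range_succ_le_of_contraction
    (a := fun t => ∑ i, ‖agentDev (y t) i‖ ^ 2)
    (b := fun t => ∑ i, ‖g (t + 1) i - g t i‖ ^ 2) (q := (1 + connectivity W ^ 2) / 2)
    (c := 2 * connectivity W ^ 2 / (1 - connectivity W ^ 2))
    (by positivity) (by linarith) (fun t => by positivity) (fun t => by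
      rw [h.y_succ]
      refine (sum_norm_sq_agentDev_mix_sub_le hn hW hl _ _).trans ?_
      refine add_le_add_right (mul_le_mul_of_nonneg_left ?_ (by positivity)) _
      refine (sum_norm_sq_agentDev_le hn _).trans_eq ?_
      simp only [Pi.sub_apply, norm_sub_rev (g t _)]) m
  rw [← hq] at h1
  refine h1.trans ?_
  gcongr

variable {f : Fin n → Vec d → ℝ} {L : ℝ}

/-- Pythagoras splits the displacement into its deviation part and the motion of the mean, which is
`-α` times the mean stochastic gradient. -/
theorem sum_norm_sq_x_succ_sub (h : IsGTRun W α x y g) (hn : 0 < n)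
    (hW : W ∈ doublyStochastic ℝ (Fin n)) (t : ℕ) :
    ∑ i, ‖x (t + 1) i - x t i‖ ^ 2 ≤
      2 * ∑ i, ‖agentDev (x (t + 1)) i‖ ^ 2 + 2 * ∑ i, ‖agentDev (x t) i‖ ^ 2
        + n * α ^ 2 * ‖agentMean (g t)‖ ^ 2 := by
  have e := sum_norm_sq_eq_agentDev_add hn (x (t + 1) - x t)
  simp only [Pi.sub_apply, agentMean_sub, agentDev_sub] at e
  rw [e, h.agentMean_x_succ hW, sub_sub_cancel_left, norm_neg, norm_smul, mul_pow,
    Real.norm_eq_abs, sq_abs, mul_assoc, Finset.mul_sum, Finset.mul_sum,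
    ← Finset.sum_add_distrib]
  gcongr
  exact norm_sub_sq_le_two_mul _ _

theorem norm_sq_agentMean_g_le (t : ℕ) :
    ‖agentMean (g t)‖ ^ 2 ≤ 2 * ‖agentMean fun i => gradient (f i) (x t i)‖ ^ 2
      + 2 * ‖agentMean fun i => g t i - gradient (f i) (x t i)‖ ^ 2 := by
  have : agentMean (g t) = agentMean (fun i => gradient (f i) (x t i))
      + agentMean fun i => g t i - gradient (f i) (x t i) := by
    rw [← agentMean_add]
    congr 1; ext1 i; simp
  rw [this]
  exact norm_add_sq_le_two_mul _ _

theorem norm_sq_g_succ_sub_le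
    (hL : ∀ i x y, ‖gradient (f i) x - gradient (f i) y‖ ≤ L * ‖x - y‖) (t : ℕ) (i : Fin n) :
    ‖g (t + 1) i - g t i‖ ^ 2 ≤ 2 * L ^ 2 * ‖x (t + 1) i - x t i‖ ^ 2
      + 4 * ‖g (t + 1) i - gradient (f i) (x (t + 1) i)‖ ^ 2
      + 4 * ‖g t i - gradient (f i) (x t i)‖ ^ 2 := by
  have e : g (t + 1) i - g t i =
      (gradient (f i) (x (t + 1) i) - gradient (f i) (x t i))
      + ((g (t + 1) i - gradient (f i) (x (t + 1) i)) - (g t i - gradient (f i) (x t i))) := by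
    abel
  have h1 := norm_add_sq_le_two_mul (gradient (f i) (x (t + 1) i) - gradient (f i) (x t i))
    ((g (t + 1) i - gradient (f i) (x (t + 1) i)) - (g t i - gradient (f i) (x t i)))
  rw [← e] at h1
  have h2 := norm_sub_sq_le_two_mul (g (t + 1) i - gradient (f i) (x (t + 1) i))
    (g t i - gradient (f i) (x t i))
  have h3 := pow_le_pow_left₀ (norm_nonneg _) (hL i (x (t + 1) i) (x t i)) 2
  rw [mul_pow] at h3
  linarith

theorem sum_norm_sq_g_succ_sub_le (h : IsGTRun W α x y g) (hn : 0 < n)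
    (hW : W ∈ doublyStochastic ℝ (Fin n))
    (hL : ∀ i x y, ‖gradient (f i) x - gradient (f i) y‖ ≤ L * ‖x - y‖) (m : ℕ) :
    ∑ t ∈ Finset.range m, ∑ i, ‖g (t + 1) i - g t i‖ ^ 2 ≤
      8 * L ^ 2 * ∑ t ∈ Finset.range (m + 1), ∑ i, ‖agentDev (x t) i‖ ^ 2
      + 4 * L ^ 2 * n * α ^ 2 * ∑ t ∈ Finset.range (m + 1),
          ‖agentMean fun i => gradient (f i) (x t i)‖ ^ 2
      + 4 * L ^ 2 * n * α ^ 2 * ∑ t ∈ Finset.range (m + 1),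
          ‖agentMean fun i => g t i - gradient (f i) (x t i)‖ ^ 2
      + 8 * ∑ t ∈ Finset.range (m + 1), ∑ i, ‖g t i - gradient (f i) (x t i)‖ ^ 2 := by
  have hstep : ∀ t, ∑ i, ‖g (t + 1) i - g t i‖ ^ 2 ≤
      4 * L ^ 2 * ∑ i, ‖agentDev (x (t + 1)) i‖ ^ 2 + 4 * L ^ 2 * ∑ i, ‖agentDev (x t) i‖ ^ 2
      + 4 * L ^ 2 * n * α ^ 2 * ‖agentMean fun i => gradient (f i) (x t i)‖ ^ 2
      + 4 * L ^ 2 * n * α ^ 2 * ‖agentMean fun i => g t i - gradient (f i) (x t i)‖ ^ 2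
      + 4 * ∑ i, ‖g (t + 1) i - gradient (f i) (x (t + 1) i)‖ ^ 2
      + 4 * ∑ i, ‖g t i - gradient (f i) (x t i)‖ ^ 2 := by
    intro t
    have h1 := Finset.sum_le_sum fun i (_ : i ∈ Finset.univ) =>
      norm_sq_g_succ_sub_le (x := x) (g := g) hL t i
    simp only [Finset.sum_add_distrib, ← Finset.mul_sum] at h1
    have h2 := h.sum_norm_sq_x_succ_sub hn hW t
    have h3 := norm_sq_agentMean_g_le (f := f) (x := x) (g := g) t
    have h4 : 0 ≤ 2 * L ^ 2 := by positivity
    have h5 : 0 ≤ 2 * L ^ 2 * (n * α ^ 2) := by positivity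
    nlinarith [mul_le_mul_of_nonneg_left h2 h4, mul_le_mul_of_nonneg_left h3 h5]
  have hsum := Finset.sum_le_sum fun t (_ : t ∈ Finset.range m) => hstep t
  simp only [Finset.sum_add_distrib, ← Finset.mul_sum] at hsum
  have hshift : ∀ a : ℕ → ℝ, (∀ t, 0 ≤ a t) →
      ∑ t ∈ Finset.range m, a (t + 1) ≤ ∑ t ∈ Finset.range (m + 1), a t := by
    intro a ha
    rw [Finset.sum_range_succ']
    linarith [ha 0]
  have hlast : ∀ a : ℕ → ℝ, (∀ t, 0 ≤ a t) →
      ∑ t ∈ Finset.range m, a t ≤ ∑ t ∈ Finset.range (m + 1), a t := by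
    intro a ha
    rw [Finset.sum_range_succ]
    linarith [ha m]
  have s1 := hshift (fun t => ∑ i, ‖agentDev (x t) i‖ ^ 2) fun t => by positivity
  have s2 := hlast (fun t => ∑ i, ‖agentDev (x t) i‖ ^ 2) fun t => by positivity
  have s3 := hlast (fun t => ‖agentMean fun i => gradient (f i) (x t i)‖ ^ 2)
    fun t => by positivity
  have s4 := hlast (fun t => ‖agentMean fun i => g t i - gradient (f i) (x t i)‖ ^ 2)
    fun t => by positivity
  have s5 := hshift (fun t => ∑ i, ‖g t i - gradient (f i) (x t i)‖ ^ 2) fun t => by positivity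
  have s6 := hlast (fun t => ∑ i, ‖g t i - gradient (f i) (x t i)‖ ^ 2) fun t => by positivity
  have c1 : 0 ≤ 4 * L ^ 2 := by positivity
  have c2 : 0 ≤ 4 * L ^ 2 * n * α ^ 2 := by positivity
  linarith [mul_le_mul_of_nonneg_left s1 c1, mul_le_mul_of_nonneg_left s2 c1,
    mul_le_mul_of_nonneg_left s3 c2, mul_le_mul_of_nonneg_left s4 c2]

theorem sum_norm_sq_agentDev_g_zero_le (hn : 0 < n) :
    ∑ i, ‖agentDev (g 0) i‖ ^ 2 ≤
      2 * (n * deltaG f (x 0)) + 2 * ∑ i, ‖g 0 i - gradient (f i) (x 0 i)‖ ^ 2 := by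
  have hn' : (n : ℝ) ≠ 0 := by positivity
  have e : g 0 = (fun i => gradient (f i) (x 0 i)) + fun i => g 0 i - gradient (f i) (x 0 i) := by
    ext1 i; simp
  have hG : n * deltaG f (x 0) = ∑ i, ‖agentDev (fun i => gradient (f i) (x 0 i)) i‖ ^ 2 := by
    simp [deltaG, agentDev, agentMean, hn']
  have h1 := sum_norm_sq_agentDev_le hn fun i => g 0 i - gradient (f i) (x 0 i)
  rw [hG]
  have h2 : ∑ i, ‖agentDev (g 0) i‖ ^ 2 ≤
      2 * ∑ i, ‖agentDev (fun i => gradient (f i) (x 0 i)) i‖ ^ 2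
      + 2 * ∑ i, ‖agentDev (fun i => g 0 i - gradient (f i) (x 0 i)) i‖ ^ 2 := by
    rw [Finset.mul_sum, Finset.mul_sum, ← Finset.sum_add_distrib]
    refine Finset.sum_le_sum fun i _ => ?_
    conv_lhs => rw [e, agentDev_add]
    exact norm_add_sq_le_two_mul _ _
  linarith

/-- The accumulated consensus error, for a step-size below the consensus threshold. -/
theorem sum_agentDev_x_le_of_threshold (h : IsGTRun W α x y g) (hn : 0 < n)
    (hW : W ∈ doublyStochastic ℝ (Fin n)) (hl : connectivity W ^ 2 < 1)
    (hL : ∀ i x y, ‖gradient (f i) x - gradient (f i) y‖ ≤ L * ‖x - y‖)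
    (hα : 768 * α ^ 2 * L ^ 2 * connectivity W ^ 4 ≤ (1 - connectivity W ^ 2) ^ 4) (m : ℕ) :
    5 / 6 * ∑ t ∈ Finset.range (m + 1), ∑ i, ‖agentDev (x t) i‖ ^ 2 ≤
      2 * (n * deltaX (x 0)) / (1 - connectivity W ^ 2)
      + 16 * α ^ 2 * connectivity W ^ 4 * (n * deltaG f (x 0)) / (1 - connectivity W ^ 2) ^ 3
      + 1 / 12 * n * α ^ 2 * (∑ t ∈ Finset.range (m + 1),
          ‖agentMean fun i => gradient (f i) (x t i)‖ ^ 2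
        + ∑ t ∈ Finset.range (m + 1), ‖agentMean fun i => g t i - gradient (f i) (x t i)‖ ^ 2)
      + 144 * (α ^ 2 * connectivity W ^ 4 / (1 - connectivity W ^ 2) ^ 4) *
        ∑ t ∈ Finset.range (m + 1), ∑ i, ‖g t i - gradient (f i) (x t i)‖ ^ 2 := by
  have hn' : (n : ℝ) ≠ 0 := by positivity
  have hSX : 0 ≤ ∑ t ∈ Finset.range (m + 1), ∑ i, ‖agentDev (x t) i‖ ^ 2 :=
    Finset.sum_nonneg fun t _ => Finset.sum_nonneg fun i _ => sq_nonneg _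
  have hSHB : 0 ≤ ∑ t ∈ Finset.range (m + 1), ‖agentMean fun i => gradient (f i) (x t i)‖ ^ 2
      + ∑ t ∈ Finset.range (m + 1), ‖agentMean fun i => g t i - gradient (f i) (x t i)‖ ^ 2 :=
    add_nonneg (Finset.sum_nonneg fun t _ => sq_nonneg _)
      (Finset.sum_nonneg fun t _ => sq_nonneg _)
  have hSZ : 0 ≤ ∑ t ∈ Finset.range (m + 1), ∑ i, ‖g t i - gradient (f i) (x t i)‖ ^ 2 :=
    Finset.sum_nonneg fun t _ => Finset.sum_nonneg fun i _ => sq_nonneg _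
  have hX0 : n * deltaX (x 0) = ∑ i, ‖agentDev (x 0) i‖ ^ 2 := by
    simp [deltaX, agentDev, agentMean, hn']
  have hxs := h.sum_agentDev_x_le hn hW hl m
  have hys := h.sum_agentDev_y_le hn hW hl m
  have hgs := h.sum_norm_sq_g_succ_sub_le hn hW hL m
  have hg0 := sum_norm_sq_agentDev_g_zero_le (f := f) (x := x) (g := g) hn
  rw [← hX0] at hxs
  have hz0 : ∑ i, ‖g 0 i - gradient (f i) (x 0 i)‖ ^ 2 ≤
      ∑ t ∈ Finset.range (m + 1), ∑ i, ‖g t i - gradient (f i) (x t i)‖ ^ 2 :=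
    Finset.single_le_sum (f := fun t => ∑ i, ‖g t i - gradient (f i) (x t i)‖ ^ 2)
      (fun t _ => by positivity) (by simp)
  have hylast : ∑ t ∈ Finset.range m, ∑ i, ‖agentDev (y t) i‖ ^ 2 ≤
      ∑ t ∈ Finset.range (m + 1), ∑ i, ‖agentDev (y t) i‖ ^ 2 := by
    rw [Finset.sum_range_succ]
    exact le_add_of_nonneg_right (by positivity)
  exact consensus_arith hl (Nat.cast_nonneg n) hSX hSHB hSZ
    hα hxs hylast hys hgs hg0 hz0

/-- The descent lemma at the mean model, with the inner product of the true and the averaged local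
gradient polarised. Their gap is controlled by consensus, and `α * L ≤ 1 / 4` leaves a quarter of
the averaged gradient's square to absorb later terms. -/
theorem globalCost_step_le (h : IsGTRun W α x y g) (hn : 0 < n)
    (hW : W ∈ doublyStochastic ℝ (Fin n)) (hα0 : 0 ≤ α) (hαL : α * L ≤ 1 / 4) (hL0 : 0 ≤ L)
    (hf : ∀ i, Differentiable ℝ (f i))
    (hL : ∀ i x y, ‖gradient (f i) x - gradient (f i) y‖ ≤ L * ‖x - y‖) (t : ℕ) :
    α / 2 * ‖gradient (globalCost f) (agentMean (x t))‖ ^ 2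
      + α / 4 * ‖agentMean fun i => gradient (f i) (x t i)‖ ^ 2 ≤
    globalCost f (agentMean (x t)) - globalCost f (agentMean (x (t + 1)))
      - α * inner ℝ (gradient (globalCost f) (agentMean (x t)))
          (agentMean fun i => g t i - gradient (f i) (x t i))
      + α ^ 2 * L * ‖agentMean fun i => g t i - gradient (f i) (x t i)‖ ^ 2
      + α * L ^ 2 / (2 * n) * ∑ i, ‖agentDev (x t) i‖ ^ 2 := by
  have hn' : (0 : ℝ) < n := by positivity
  have hdes := descent_lemma (differentiable_globalCost hf)
    (norm_gradient_globalCost_sub_le hn hf hL) (agentMean (x t)) (-(α • agentMean (g t)))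
  rw [← sub_eq_add_neg, ← h.agentMean_x_succ hW] at hdes
  have hgb := norm_sq_agentMean_g_le (f := f) (x := x) (g := g) t
  have hge : agentMean (g t) = agentMean (fun i => gradient (f i) (x t i))
      + agentMean fun i => g t i - gradient (f i) (x t i) := by
    rw [← agentMean_add]
    congr 1; ext1 i; simp
  have hgap : ‖gradient (globalCost f) (agentMean (x t))
      - agentMean fun i => gradient (f i) (x t i)‖ ^ 2 ≤
      L ^ 2 / n * ∑ i, ‖agentDev (x t) i‖ ^ 2 := by
    rw [gradient_globalCost hf, ← agentMean_sub]
    have h1 := mul_norm_sq_agentMean_le hn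
      ((fun i => gradient (f i) (agentMean (x t))) - fun i => gradient (f i) (x t i))
    have h2 : ∑ i, ‖((fun i => gradient (f i) (agentMean (x t)))
        - fun i => gradient (f i) (x t i)) i‖ ^ 2 ≤ L ^ 2 * ∑ i, ‖agentDev (x t) i‖ ^ 2 := by
      rw [Finset.mul_sum]
      refine Finset.sum_le_sum fun i _ => ?_
      rw [← mul_pow]
      refine pow_le_pow_left₀ (norm_nonneg _) ?_ 2
      rw [agentDev, norm_sub_rev (x t i)]
      exact hL i _ _
    rw [div_mul_eq_mul_div, le_div_iff₀ hn', mul_comm]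
    exact h1.trans h2
  have hpol := norm_sub_sq_real (gradient (globalCost f) (agentMean (x t)))
    (agentMean fun i => gradient (f i) (x t i))
  rw [norm_neg, norm_smul, mul_pow, Real.norm_eq_abs, sq_abs, inner_neg_right,
    real_inner_smul_right] at hdes
  nth_rewrite 1 [hge] at hdes
  rw [inner_add_right] at hdes
  have hc : 0 ≤ L / 2 * α ^ 2 := by positivity
  have h1 := mul_le_mul_of_nonneg_left hgb hc
  have h2 := mul_le_mul_of_nonneg_left hgap (by positivity : 0 ≤ α / 2)
  have h3 : α * (α * L) * ‖agentMean fun i => gradient (f i) (x t i)‖ ^ 2 ≤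
      α * (1 / 4) * ‖agentMean fun i => gradient (f i) (x t i)‖ ^ 2 := by gcongr
  have h4 : α * L ^ 2 / (2 * n) = α / 2 * (L ^ 2 / n) := by
    field_simp
  rw [hpol] at h2
  rw [h4]
  nlinarith

/-- Pathwise bound of the squared gradients along a run by the initial gaps and the noise. -/
theorem sum_norm_sq_gradient_le (h : IsGTRun W α x y g) (hn : 0 < n)
    (hW : W ∈ doublyStochastic ℝ (Fin n)) (hl : connectivity W ^ 2 < 1) (hL0 : 0 ≤ L)
    (hf : ∀ i, Differentiable ℝ (f i))
    (hL : ∀ i x y, ‖gradient (f i) x - gradient (f i) y‖ ≤ L * ‖x - y‖)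
    (hbdd : BddBelow (Set.range (globalCost f)))
    (hα0 : 0 ≤ α) (hαL : α * L ≤ 1 / 4)
    (hα : 768 * α ^ 2 * L ^ 2 * connectivity W ^ 4 ≤ (1 - connectivity W ^ 2) ^ 4) (m : ℕ) :
    ∑ t ∈ Finset.range (m + 1), (α / 2 * ‖gradient (globalCost f) (agentMean (x t))‖ ^ 2
      + α * L ^ 2 / (6 * n) * ∑ i, ‖agentDev (x t) i‖ ^ 2) ≤
    deltaF f (x 0)
      + ∑ t ∈ Finset.range (m + 1),
        (-α * inner ℝ (gradient (globalCost f) (agentMean (x t)))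
            (agentMean fun i => g t i - gradient (f i) (x t i))
          + 2 * α ^ 2 * L * ‖agentMean fun i => g t i - gradient (f i) (x t i)‖ ^ 2
          + 120 * (α ^ 3 * L ^ 2 * connectivity W ^ 4 / (1 - connectivity W ^ 2) ^ 4) / n *
            ∑ i, ‖g t i - gradient (f i) (x t i)‖ ^ 2)
      + 4 / 5 * α * L ^ 2 * (2 * deltaX (x 0) / (1 - connectivity W ^ 2)
        + 16 * α ^ 2 * connectivity W ^ 4 * deltaG f (x 0) / (1 - connectivity W ^ 2) ^ 3) := by
  have hn' : (0 : ℝ) < n := by positivity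
  have hcons := h.sum_agentDev_x_le_of_threshold hn hW hl hL hα m
  have hstep := Finset.sum_le_sum fun t (_ : t ∈ Finset.range (m + 1)) =>
    h.globalCost_step_le hn hW hα0 hαL hL0 hf hL t
  have htel : ∑ t ∈ Finset.range (m + 1),
      (globalCost f (agentMean (x t)) - globalCost f (agentMean (x (t + 1)))) ≤
      deltaF f (x 0) := by
    rw [Finset.sum_range_sub' fun t => globalCost f (agentMean (x t)), deltaF]
    have := ciInf_le hbdd (agentMean (x (m + 1)))
    linarith
  simp only [Finset.sum_add_distrib, Finset.sum_sub_distrib, ← Finset.mul_sum] at hstep htel ⊢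
  have hSH : 0 ≤ ∑ t ∈ Finset.range (m + 1), ‖agentMean fun i => gradient (f i) (x t i)‖ ^ 2 := by
    positivity
  have hSB : 0 ≤ ∑ t ∈ Finset.range (m + 1),
      ‖agentMean fun i => g t i - gradient (f i) (x t i)‖ ^ 2 := by positivity
  have hSZ : 0 ≤ ∑ t ∈ Finset.range (m + 1), ∑ i, ‖g t i - gradient (f i) (x t i)‖ ^ 2 := by
    positivity
  generalize (∑ t ∈ Finset.range (m + 1), ∑ i, ‖agentDev (x t) i‖ ^ 2) = SX at *
  generalize (∑ t ∈ Finset.range (m + 1), ‖agentMean fun i => gradient (f i) (x t i)‖ ^ 2) = SH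
    at *
  generalize (∑ t ∈ Finset.range (m + 1),
      ‖agentMean fun i => g t i - gradient (f i) (x t i)‖ ^ 2) = SB at *
  generalize (∑ t ∈ Finset.range (m + 1), ∑ i, ‖g t i - gradient (f i) (x t i)‖ ^ 2) = SZ at *
  generalize connectivity W = l at *
  -- The weight 4/5 is chosen because `4 / 5 * (5 / 6) = 1 / 2 + 1 / 6`: the half cancels the
  -- consensus term of the descent step, and the sixth stays on the left to convert gradients at the
  -- mean into gradients at the agents.
  have hc : 0 ≤ 4 / 5 * α * L ^ 2 / n := by positivity
  have h1 := mul_le_mul_of_nonneg_left hcons hc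
  have e1 : 4 / 5 * α * L ^ 2 / n * (5 / 6 * SX) =
      α * L ^ 2 / (2 * n) * SX + α * L ^ 2 / (6 * n) * SX := by
    field_simp; ring
  have e2 : ∀ A B D E F : ℝ, 4 / 5 * α * L ^ 2 / n * (2 * (n * A) / B
      + 16 * α ^ 2 * l ^ 4 * (n * D) / E + 1 / 12 * n * α ^ 2 * (SH + SB)
      + 144 * (α ^ 2 * l ^ 4 / F) * SZ) =
      4 / 5 * α * L ^ 2 * (2 * A / B + 16 * α ^ 2 * l ^ 4 * D / E)
      + 1 / 15 * α * (α * L) ^ 2 * (SH + SB)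
      + 576 / 5 * (α ^ 3 * L ^ 2 * l ^ 4 / F) / n * SZ := by
    intro A B D E F
    have : 4 / 5 * α * L ^ 2 / n * (2 * (n * A) / B
      + 16 * α ^ 2 * l ^ 4 * (n * D) / E + 1 / 12 * n * α ^ 2 * (SH + SB)
      + 144 * (α ^ 2 * l ^ 4 / F) * SZ) =
      4 / 5 * α * L ^ 2 * (n / n) * (2 * A / B + 16 * α ^ 2 * l ^ 4 * D / E
      + 1 / 12 * α ^ 2 * (SH + SB))
      + 576 / 5 * (α ^ 3 * L ^ 2 * l ^ 4 / F) / n * SZ := by ring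
    rw [this, div_self hn'.ne']
    ring
  rw [e1, e2] at h1
  have hαL0 : 0 ≤ α * L := by positivity
  have h2 : 1 / 15 * α * (α * L) ^ 2 * SH ≤ 1 / 4 * α * SH := by
    have : (α * L) ^ 2 ≤ 1 := by nlinarith
    have : α * SH * (α * L) ^ 2 ≤ α * SH * 1 := by gcongr
    have : 0 ≤ α * SH := by positivity
    nlinarith
  have h3 : 1 / 15 * α * (α * L) ^ 2 * SB ≤ α ^ 2 * L * SB := by
    have : α ^ 2 * L * SB * (α * L) ≤ α ^ 2 * L * SB * (1 / 4) := by gcongr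
    have : 0 ≤ α ^ 2 * L * SB := by positivity
    nlinarith
  have h4 : 576 / 5 * (α ^ 3 * L ^ 2 * l ^ 4 / (1 - l ^ 2) ^ 4) / n * SZ ≤
      120 * (α ^ 3 * L ^ 2 * l ^ 4 / (1 - l ^ 2) ^ 4) / n * SZ := by
    gcongr; norm_num
  linarith

end IsGTRun

/-! ### Conditional assumptions as statements about frozen parameters. -/

section Freezing

variable {Ω E Ξ : Type*} {H mΩ : MeasurableSpace Ω} {mE : MeasurableSpace E}
  {mΞ : MeasurableSpace Ξ} {μ : Measure Ω} [IsProbabilityMeasure μ]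

theorem map_prodMk_eq_of_indep (hH : H ≤ mΩ) {X : Ω → E} {Y : Ω → Ξ}
    (hX : Measurable[H] X) (hY : Measurable Y) (hind : Indep H (mΞ.comap Y) μ) :
    μ.map (fun ω => (X ω, Y ω)) = (μ.map X).prod (μ.map Y) := by
  have h : IndepFun X Y μ := by
    rw [IndepFun_iff_Indep]
    exact indep_of_indep_of_le_left hind hX.comap_le
  exact (indepFun_iff_map_prod_eq_prod_map_map (hX.mono hH le_rfl).aemeasurable
    hY.aemeasurable).1 h

/-- Conditionally on `X`, an independent `Y` may be integrated with `X` frozen. -/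
theorem lintegral_eq_lintegral_lintegral_of_indep (hH : H ≤ mΩ)
    {X : Ω → E} {Y : Ω → Ξ} (hX : Measurable[H] X) (hY : Measurable Y)
    (hind : Indep H (mΞ.comap Y) μ) {φ : E × Ξ → ℝ≥0∞} (hφ : Measurable φ) :
    ∫⁻ ω, φ (X ω, Y ω) ∂μ = ∫⁻ ω, ∫⁻ ω', φ (X ω, Y ω') ∂μ ∂μ := by
  have hX' : Measurable X := hX.mono hH le_rfl
  have h1 : ∫⁻ ω, φ (X ω, Y ω) ∂μ = ∫⁻ p, φ p ∂(μ.map fun ω => (X ω, Y ω)) :=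
    (lintegral_map hφ (hX'.prodMk hY)).symm
  rw [h1, map_prodMk_eq_of_indep hH hX hY hind, lintegral_prod _ hφ.aemeasurable,
    lintegral_map hφ.lintegral_prod_right' hX']
  refine lintegral_congr fun ω => ?_
  exact lintegral_map (hφ.comp measurable_prodMk_left) hY

/-- The conclusion no longer mentions `H`: it concerns only the law of `X` and the frozen integrals.
Hence it remains usable with a finer history independent of the sample. It is tested on sets `X ⁻¹'
B`, which lie in `H`. -/
theorem ae_lintegral_le_of_condLExp_le (hH : H ≤ mΩ) {X : Ω → E}
    {Y : Ω → Ξ} (hX : Measurable[H] X) (hY : Measurable Y) (hind : Indep H (mΞ.comap Y) μ)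
    {φ : E × Ξ → ℝ≥0∞} (hφ : Measurable φ) {b : E → ℝ≥0∞} (hb : Measurable b)
    (h : condLExp H μ (fun ω => φ (X ω, Y ω)) ≤ᵐ[μ] fun ω => b (X ω)) :
    ∀ᵐ ω ∂μ, ∫⁻ ω', φ (X ω, Y ω') ∂μ ≤ b (X ω) := by
  have hX' : Measurable X := hX.mono hH le_rfl
  have hΦ : ∀ x, ∫⁻ y, φ (x, y) ∂(μ.map Y) = ∫⁻ ω', φ (x, Y ω') ∂μ := fun x =>
    lintegral_map (hφ.comp measurable_prodMk_left) hY
  have : IsProbabilityMeasure (μ.map X) := Measure.isProbabilityMeasure_map hX'.aemeasurable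
  have key : (fun x => ∫⁻ y, φ (x, y) ∂(μ.map Y)) ≤ᵐ[μ.map X] b := by
    refine ae_le_of_forall_setLIntegral_le_of_sigmaFinite hφ.lintegral_prod_right'
      fun B hB _ => ?_
    have h1 : ∫⁻ x in B, ∫⁻ y, φ (x, y) ∂(μ.map Y) ∂(μ.map X) =
        ∫⁻ ω in X ⁻¹' B, φ (X ω, Y ω) ∂μ := by
      -- Placing the indicator of `B` inside the integrand makes the unrestricted freezing formula
      -- apply to the set integral.
      have e := lintegral_eq_lintegral_lintegral_of_indep hH hX hY hind
        (φ := fun p => B.indicator (fun _ => (1 : ℝ≥0∞)) p.1 * φ p)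
        (((measurable_const.indicator hB).comp measurable_fst).mul hφ)
      rw [setLIntegral_map hB hφ.lintegral_prod_right' hX', ← lintegral_indicator (hX' hB),
        ← lintegral_indicator (hX' hB)]
      have e1 : ∀ ω, (X ⁻¹' B).indicator (fun ω => φ (X ω, Y ω)) ω =
          B.indicator (fun _ => (1 : ℝ≥0∞)) (X ω) * φ (X ω, Y ω) := by
        intro ω
        by_cases hω : X ω ∈ B <;> simp [Set.indicator, hω]
      have e2 : ∀ ω, (X ⁻¹' B).indicator (fun ω => ∫⁻ y, φ (X ω, y) ∂(μ.map Y)) ω =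
          ∫⁻ ω', B.indicator (fun _ => (1 : ℝ≥0∞)) (X ω) * φ (X ω, Y ω') ∂μ := by
        intro ω
        by_cases hω : X ω ∈ B <;> simp [Set.indicator, hω, hΦ]
      simp only [e1, e2]
      exact e.symm
    rw [h1, setLIntegral_map hB hb hX', ← setLIntegral_condLExp hH μ _ (hX hB)]
    exact lintegral_mono_ae (ae_restrict_of_ae h)
  filter_upwards [ae_of_ae_map hX'.aemeasurable key] with ω hω
  rwa [← hΦ]

variable {V : Type*} [NormedAddCommGroup V] [NormedSpace ℝ V] [CompleteSpace V]
  [MeasurableSpace V] [BorelSpace V] [SecondCountableTopology V]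

theorem ae_integral_eq_zero_of_condExp_eq_zero (hH : H ≤ mΩ) {X : Ω → E}
    {Y : Ω → Ξ} (hX : Measurable[H] X) (hY : Measurable Y) (hind : Indep H (mΞ.comap Y) μ)
    {φ : E × Ξ → V} (hφ : Measurable φ) (hint : Integrable (fun ω => φ (X ω, Y ω)) μ)
    (h : condExp H μ (fun ω => φ (X ω, Y ω)) =ᵐ[μ] 0) :
    ∀ᵐ ω ∂μ, Integrable (fun ω' => φ (X ω, Y ω')) μ ∧ ∫ ω', φ (X ω, Y ω') ∂μ = 0 := by
  have hX' : Measurable X := hX.mono hH le_rfl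
  have hφs : StronglyMeasurable φ := hφ.stronglyMeasurable
  have hmap := map_prodMk_eq_of_indep hH hX hY hind
  have : IsProbabilityMeasure (μ.map X) := Measure.isProbabilityMeasure_map hX'.aemeasurable
  have : IsProbabilityMeasure (μ.map Y) := Measure.isProbabilityMeasure_map hY.aemeasurable
  have hintp : Integrable φ ((μ.map X).prod (μ.map Y)) := by
    rw [← hmap]
    exact (integrable_map_measure hφs.aestronglyMeasurable
      (hX'.prodMk hY).aemeasurable).2 hint
  have key : (fun x => ∫ y, φ (x, y) ∂(μ.map Y)) =ᵐ[μ.map X] 0 := by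
    refine ae_eq_zero_of_forall_setIntegral_eq_of_sigmaFinite
      (fun B hB _ => hintp.integral_prod_left.integrableOn) fun B hB _ => ?_
    have h1 : ∫ x in B, ∫ y, φ (x, y) ∂(μ.map Y) ∂(μ.map X) =
        ∫ p in B ×ˢ Set.univ, φ p ∂((μ.map X).prod (μ.map Y)) := by
      rw [setIntegral_prod _ hintp.integrableOn, Measure.restrict_univ]
    rw [h1, ← hmap, setIntegral_map (hB.prod MeasurableSet.univ) hφs.aestronglyMeasurable
      (hX'.prodMk hY).aemeasurable]
    have h2 : (fun ω => (X ω, Y ω)) ⁻¹' B ×ˢ Set.univ = X ⁻¹' B := by ext; simp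
    rw [h2, ← setIntegral_condExp hH hint (hX hB), setIntegral_congr_ae (hH _ (hX hB))
      (g := fun _ => 0) (by filter_upwards [h] with ω hω _; exact hω)]
    simp
  filter_upwards [ae_of_ae_map hX'.aemeasurable key,
    ae_of_ae_map hX'.aemeasurable hintp.prod_right_ae] with ω h1 h2
  have hm : AEStronglyMeasurable (fun y => φ (X ω, y)) (μ.map Y) :=
    (hφ.comp measurable_prodMk_left).stronglyMeasurable.aestronglyMeasurable
  refine ⟨(integrable_map_measure hm hY.aemeasurable).1 h2, ?_⟩
  rw [integral_map hY.aemeasurable hm] at h1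
  exact h1

end Freezing

/-! ### Integrating out the agents' noises one at a time. -/

section Sequential

variable {Ω E : Type*} {mΩ : MeasurableSpace Ω} {mE : MeasurableSpace E} {μ : Measure Ω}
  [IsProbabilityMeasure μ] {n d : ℕ}

theorem norm_add_two_smul_sq_le {V : Type*} [NormedAddCommGroup V] [NormedSpace ℝ V]
    (u S : V) {c : ℝ} (hc : 0 ≤ c) :
    2 * ‖u + (2 * c) • S‖ ^ 2 ≤ 3 * ‖u‖ ^ 2 + 24 * c ^ 2 * ‖S‖ ^ 2 := by
  have h := norm_add_le u ((2 * c) • S)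
  rw [norm_smul, Real.norm_of_nonneg (by positivity : 0 ≤ 2 * c)] at h
  have h2 := pow_le_pow_left₀ (norm_nonneg _) h 2
  nlinarith [sq_nonneg (‖u‖ - 4 * c * ‖S‖)]

/-- Expanding `‖S + Z‖ ^ 2` tilts the linear form in `Z` by `(2 * a') • S`. The moment bound charges
the square of the tilted vector; its `S` part raises the coefficient of `‖S‖ ^ 2` from `a'` to `a`,
and its `u` part enters the compensator. -/
theorem exp_sum_step {V : Type*} [NormedAddCommGroup V] [InnerProductSpace ℝ V] [CompleteSpace V]
    {Z : Ω → V} {s r a a' b c : ℝ} (hs : 0 < s) (hr : 0 ≤ r) (hZ : Integrable Z μ)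
    (hZ0 : ∫ ω, Z ω ∂μ = 0)
    (h : ∫⁻ ω, ENNReal.ofReal (Real.exp (‖Z ω‖ ^ 2 / s ^ 2)) ∂μ ≤
      ENNReal.ofReal (Real.exp (1 + r)))
    (ha' : 0 ≤ a') (hb : 0 ≤ b) (hc : a' + b ≤ c) (hcs : 2 * c * s ^ 2 ≤ 1)
    (haa : a' + 24 * a' ^ 2 * s ^ 2 ≤ a) (u S : V) (q : ℝ) :
    ∫⁻ ω, ENNReal.ofReal (Real.exp (inner ℝ u (S + Z ω) + a' * ‖S + Z ω‖ ^ 2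
        + (q + b * ‖Z ω‖ ^ 2 - (3 * ‖u‖ ^ 2 * s ^ 2 + c * s ^ 2 + r)))) ∂μ ≤
      ENNReal.ofReal (Real.exp (inner ℝ u S + a * ‖S‖ ^ 2 + q)) := by
  have hs2 : 0 < s ^ 2 := by positivity
  have hbs : 2 * (a' + b) * s ^ 2 ≤ 1 := by nlinarith
  have h1 := lintegral_exp_inner_add_norm_sq_le hs hr hZ hZ0 h (add_nonneg ha' hb) hbs
    (u + (2 * a') • S)
  have hm : AEMeasurable (fun ω => ENNReal.ofReal (Real.exp
      (inner ℝ (u + (2 * a') • S) (Z ω) + (a' + b) * ‖Z ω‖ ^ 2))) μ := by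
    have hin : AEMeasurable (fun ω => inner ℝ (u + (2 * a') • S) (Z ω)) μ :=
      (hZ.const_inner _).aestronglyMeasurable.aemeasurable
    have hno : AEMeasurable (fun ω => ‖Z ω‖) μ := hZ.aestronglyMeasurable.norm.aemeasurable
    fun_prop
  set k := inner ℝ u S + a' * ‖S‖ ^ 2 + q - (3 * ‖u‖ ^ 2 * s ^ 2 + c * s ^ 2 + r) with hk
  calc _ = ∫⁻ ω, ENNReal.ofReal (Real.exp k) * ENNReal.ofReal (Real.exp
          (inner ℝ (u + (2 * a') • S) (Z ω) + (a' + b) * ‖Z ω‖ ^ 2)) ∂μ := by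
        refine lintegral_congr fun ω => ?_
        rw [← ENNReal.ofReal_mul (Real.exp_pos _).le, ← Real.exp_add, norm_add_sq_real,
          inner_add_right, inner_add_left, real_inner_smul_left, hk]
        ring_nf
    _ = ENNReal.ofReal (Real.exp k) * ∫⁻ ω, ENNReal.ofReal (Real.exp
          (inner ℝ (u + (2 * a') • S) (Z ω) + (a' + b) * ‖Z ω‖ ^ 2)) ∂μ :=
        lintegral_const_mul'' _ hm
    _ ≤ ENNReal.ofReal (Real.exp k) * ENNReal.ofReal (Real.exp
          (2 * ‖u + (2 * a') • S‖ ^ 2 * s ^ 2 + (a' + b) * s ^ 2 + r)) := by gcongr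
    _ ≤ _ := by
        rw [← ENNReal.ofReal_mul (Real.exp_pos _).le, ← Real.exp_add]
        refine ENNReal.ofReal_le_ofReal (Real.exp_le_exp.2 ?_)
        have h2 := mul_le_mul_of_nonneg_right (norm_add_two_smul_sq_le u S ha') hs2.le
        have h3 := mul_le_mul_of_nonneg_right haa (sq_nonneg ‖S‖)
        have h4 := mul_le_mul_of_nonneg_right hc hs2.le
        rw [hk]
        linarith

/-- Independent noises, revealed one agent at a time: the exponential moment of a linear form and
of the squared norm of their sum, given the past. -/
theorem lintegral_exp_sum_noise_le {Ξ : Fin n → Type*} [∀ i, MeasurableSpace (Ξ i)]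
    (H : Finset (Fin n) → MeasurableSpace Ω) (hH : ∀ s, H s ≤ mΩ) (hmono : Monotone H)
    {Y : ∀ i, Ω → Ξ i} (hY : ∀ i, Measurable (Y i))
    (hYH : ∀ s, ∀ i ∈ s, Measurable[H s] (Y i))
    (hind : ∀ s, ∀ i ∉ s, Indep (H s) (MeasurableSpace.comap (Y i) inferInstance) μ)
    {X : Ω → E} (hX : Measurable[H ∅] X) {w : Ω → ℝ≥0∞} (hw : Measurable[H ∅] w)
    {Z : ∀ i, E × Ξ i → Vec d} (hZ : ∀ i, Measurable (Z i))
    {r : Fin n → E → ℝ} (hr : ∀ i, Measurable (r i)) (hr0 : ∀ i x, 0 ≤ r i x)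
    {u : E → Vec d} (hu : Measurable u) {σ : Fin n → ℝ} (hσ : ∀ i, 0 < σ i)
    (hZi : ∀ i, ∀ᵐ ω ∂μ, Integrable (fun ω' => Z i (X ω, Y i ω')) μ ∧
      ∫ ω', Z i (X ω, Y i ω') ∂μ = 0)
    (hZe : ∀ i, ∀ᵐ ω ∂μ,
      ∫⁻ ω', ENNReal.ofReal (Real.exp (‖Z i (X ω, Y i ω')‖ ^ 2 / σ i ^ 2)) ∂μ ≤
        ENNReal.ofReal (Real.exp (1 + r i (X ω))))
    {a b : ℝ} (ha : 0 ≤ a) (hb : 0 ≤ b) (haσ : 96 * a * ∑ i, σ i ^ 2 ≤ 1)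
    (hbσ : ∀ i, 2 * (2 * a + b) * σ i ^ 2 ≤ 1) :
    ∫⁻ ω, w ω * ENNReal.ofReal (Real.exp (inner ℝ (u (X ω)) (∑ i, Z i (X ω, Y i ω))
        + a * ‖∑ i, Z i (X ω, Y i ω)‖ ^ 2
        + ∑ i, (b * ‖Z i (X ω, Y i ω)‖ ^ 2
          - (3 * ‖u (X ω)‖ ^ 2 * σ i ^ 2 + (2 * a + b) * σ i ^ 2 + r i (X ω))))) ∂μ ≤
      ∫⁻ ω, w ω ∂μ := by
  -- The quadratic coefficient while only the agents in `s` remain in the sum. Each integration adds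
  -- at most `24 * (2 * a) ^ 2 * σ i ^ 2`, whence 96, and `haσ` keeps the total below `2 * a`. It
  -- equals `a` when `s` is everything.
  set A : Finset (Fin n) → ℝ := fun s => a + 96 * a ^ 2 * ∑ j ∈ sᶜ, σ j ^ 2 with hA
  have hA0 : ∀ s, 0 ≤ A s := fun s => by positivity
  have hA2 : ∀ s, A s ≤ 2 * a := fun s => by
    have h1 : ∑ j ∈ sᶜ, σ j ^ 2 ≤ ∑ j, σ j ^ 2 :=
      Finset.sum_le_sum_of_subset_of_nonneg (Finset.subset_univ _) fun _ _ _ => sq_nonneg _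
    have h2 : 96 * a ^ 2 * ∑ j ∈ sᶜ, σ j ^ 2 ≤ 96 * a ^ 2 * ∑ j, σ j ^ 2 := by gcongr
    simp only [hA]
    nlinarith
  have hXs : ∀ s, Measurable[H s] X := fun s => hX.mono (hmono (Finset.empty_subset s)) le_rfl
  have hws : ∀ s, Measurable[H s] w := fun s => hw.mono (hmono (Finset.empty_subset s)) le_rfl
  have key : ∀ s : Finset (Fin n),
      ∫⁻ ω, w ω * ENNReal.ofReal (Real.exp (inner ℝ (u (X ω)) (∑ i ∈ s, Z i (X ω, Y i ω))
        + A s * ‖∑ i ∈ s, Z i (X ω, Y i ω)‖ ^ 2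
        + ∑ i ∈ s, (b * ‖Z i (X ω, Y i ω)‖ ^ 2
          - (3 * ‖u (X ω)‖ ^ 2 * σ i ^ 2 + (2 * a + b) * σ i ^ 2 + r i (X ω))))) ∂μ ≤
      ∫⁻ ω, w ω ∂μ := by
    intro s
    induction s using Finset.induction_on with
    | empty => simp
    | insert i s hi ih =>
      refine le_trans ?_ ih
      have hAi : A (insert i s) + 24 * A (insert i s) ^ 2 * σ i ^ 2 ≤ A s := by
        have h1 : A s = A (insert i s) + 96 * a ^ 2 * σ i ^ 2 := by
          simp only [hA]
          rw [← Finset.insert_compl_insert hi, Finset.sum_insert (by simp)]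
          ring
        have h2 : A (insert i s) ^ 2 ≤ (2 * a) ^ 2 := pow_le_pow_left₀ (hA0 _) (hA2 _) 2
        have h3 := mul_le_mul_of_nonneg_right h2 (sq_nonneg (σ i))
        rw [h1]; linarith
      have hS : Measurable[H s] fun ω => ∑ i ∈ s, Z i (X ω, Y i ω) :=
        Finset.measurable_fun_sum s fun j hj => (hZ j).comp ((hXs s).prodMk (hYH s j hj))
      have hQ : Measurable[H s] fun ω => ∑ i ∈ s, (b * ‖Z i (X ω, Y i ω)‖ ^ 2
          - (3 * ‖u (X ω)‖ ^ 2 * σ i ^ 2 + (2 * a + b) * σ i ^ 2 + r i (X ω))) := by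
        refine Finset.measurable_fun_sum s fun j hj => ?_
        have hm : Measurable fun p : E × Ξ j => b * ‖Z j p‖ ^ 2
          - (3 * ‖u p.1‖ ^ 2 * σ j ^ 2 + (2 * a + b) * σ j ^ 2 + r j p.1) := by
          have := hZ j
          have := hr j
          fun_prop
        exact hm.comp ((hXs s).prodMk (hYH s j hj))
      -- The frozen data are the past weight, the models, the partial noise sum and the partial
      -- compensated sum; only agent `i`'s sample is integrated.
      let φ : ((ℝ≥0∞ × E) × (Vec d × ℝ)) × Ξ i → ℝ≥0∞ := fun p =>
        p.1.1.1 * ENNReal.ofReal (Real.exp (inner ℝ (u p.1.1.2) (p.1.2.1 + Z i (p.1.1.2, p.2))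
          + A (insert i s) * ‖p.1.2.1 + Z i (p.1.1.2, p.2)‖ ^ 2
          + (p.1.2.2 + b * ‖Z i (p.1.1.2, p.2)‖ ^ 2
            - (3 * ‖u p.1.1.2‖ ^ 2 * σ i ^ 2 + (2 * a + b) * σ i ^ 2 + r i p.1.1.2))))
      have hφ : Measurable φ := by
        have hz : Measurable fun p : ((ℝ≥0∞ × E) × (Vec d × ℝ)) × Ξ i =>
          Z i (p.1.1.2, p.2) := (hZ i).comp (by fun_prop)
        have := hr i
        simp only [φ]
        fun_prop
      have hfr := lintegral_eq_lintegral_lintegral_of_indep (hH s)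
        (((hws s).prodMk (hXs s)).prodMk (hS.prodMk hQ)) (hY i) (hind s i hi) hφ
      calc _ = ∫⁻ ω, φ (((w ω, X ω), (∑ i ∈ s, Z i (X ω, Y i ω),
              ∑ i ∈ s, (b * ‖Z i (X ω, Y i ω)‖ ^ 2
                - (3 * ‖u (X ω)‖ ^ 2 * σ i ^ 2 + (2 * a + b) * σ i ^ 2 + r i (X ω))))), Y i ω)
              ∂μ := by
            refine lintegral_congr fun ω => ?_
            simp only [φ, Finset.sum_insert hi]
            rw [add_comm (Z i (X ω, Y i ω))]
            congr 4
            ring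
        _ = _ := hfr
        _ ≤ _ := by
            refine lintegral_mono_ae ?_
            filter_upwards [hZi i, hZe i] with ω h1 h2
            simp only [φ]
            rw [lintegral_const_mul]
            · gcongr
              exact exp_sum_step (hσ i) (hr0 i _) h1.1 h1.2 h2 (hA0 _) hb
                (add_le_add_left (hA2 _) b) (hbσ i) hAi _ _ _
            · have hz : Measurable fun ω' => Z i (X ω, Y i ω') :=
                (hZ i).comp (measurable_const.prodMk (hY i))
              fun_prop
  have h := key Finset.univ
  simpa [hA] using h

end Sequential

theorem isGTRun_gtState {n d : ℕ} {Ξ : Fin n → Type*} (W : Matrix (Fin n) (Fin n) ℝ)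
    (α : ℝ) (G : ∀ i, Vec d → Ξ i → Vec d) (x₁ : Fin n → Vec d) (s : ∀ i, ℕ → Ξ i) :
    IsGTRun W α (fun t => (gtState W (fun _ => α) G x₁ s t).x)
      (fun t => (gtState W (fun _ => α) G x₁ s (t + 1)).y)
      (fun t => (gtState W (fun _ => α) G x₁ s (t + 1)).g) where
  y_zero := by simp [gtState]
  y_succ t := by
    rw [sub_sub_eq_add_sub]
    rfl
  x_succ t := rfl

/-! ### The history of samples and the exponential supermartingale. -/

section History

variable {n d : ℕ} {Ω : Type*} {Ξ : Fin n → Type*} [∀ i, MeasurableSpace (Ξ i)]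

/-- The `σ`-algebra generated by the samples with index in `A`. -/
@[reducible] def sampleSigma (ξ : ∀ i, ℕ → Ω → Ξ i) (A : Set (Fin n × ℕ)) : MeasurableSpace Ω :=
  ⨆ p ∈ A, MeasurableSpace.comap (ξ p.1 p.2) inferInstance

theorem sampleSigma_mono (ξ : ∀ i, ℕ → Ω → Ξ i) : Monotone (sampleSigma ξ) :=
  fun _ _ h => biSup_mono fun _ hp => h hp

theorem measurable_sampleSigma (ξ : ∀ i, ℕ → Ω → Ξ i) {A : Set (Fin n × ℕ)} {i : Fin n} {t : ℕ}
    (h : (i, t) ∈ A) : Measurable[sampleSigma ξ A] (ξ i t) :=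
  Measurable.of_comap_le
    (le_iSup₂_of_le (f := fun (p : Fin n × ℕ) (_ : p ∈ A) =>
      MeasurableSpace.comap (ξ p.1 p.2) inferInstance) (i, t) h le_rfl)

theorem sampleSigma_le [mΩ : MeasurableSpace Ω] {ξ : ∀ i, ℕ → Ω → Ξ i}
    (hξ : ∀ i t, Measurable (ξ i t)) (A : Set (Fin n × ℕ)) : sampleSigma ξ A ≤ mΩ :=
  iSup₂_le fun p _ => (hξ p.1 p.2).comap_le

theorem indep_sampleSigma [mΩ : MeasurableSpace Ω] {μ : Measure Ω} {ξ : ∀ i, ℕ → Ω → Ξ i}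
    (hξ : ∀ i t, Measurable (ξ i t))
    (hind : iIndepFun (fun (p : Fin n × ℕ) (ω : Ω) => ξ p.1 p.2 ω) μ) {A : Set (Fin n × ℕ)}
    {i : Fin n} {t : ℕ} (h : (i, t) ∉ A) :
    Indep (sampleSigma ξ A) (MeasurableSpace.comap (ξ i t) inferInstance) μ := by
  have := indep_iSup_of_disjoint (fun p : Fin n × ℕ => (hξ p.1 p.2).comap_le) hind
    (Set.disjoint_singleton_right.2 h)
  simpa using this

/-- The σ-algebra on `Ω` is arbitrary and only samples up to time `t` need be measurable, so this
also gives adaptedness to the sample histories. -/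
theorem measurable_gtState [MeasurableSpace Ω] {G : ∀ i, Vec d → Ξ i → Vec d}
    {ξ : ∀ i, ℕ → Ω → Ξ i} (W : Matrix (Fin n) (Fin n) ℝ) (α : ℕ → ℝ)
    (x₁ : Fin n → Vec d) (hG : ∀ i, Measurable (Function.uncurry (G i))) (t : ℕ)
    (hξ : ∀ i, ∀ s ≤ t, Measurable (ξ i s)) :
    Measurable (fun ω => (gtState W α G x₁ (fun j s => ξ j s ω) t).x) ∧
    Measurable (fun ω => (gtState W α G x₁ (fun j s => ξ j s ω) t).y) ∧
    Measurable (fun ω => (gtState W α G x₁ (fun j s => ξ j s ω) t).g) := by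
  induction t with
  | zero => exact ⟨measurable_const, measurable_const, measurable_const⟩
  | succ t ih =>
    obtain ⟨hx, hy, hg⟩ := ih fun i s hs => hξ i s (hs.trans t.le_succ)
    have hmix : ∀ {v : Ω → Fin n → Vec d}, Measurable v → Measurable fun ω => mix W (v ω) := by
      intro v hv
      refine measurable_pi_lambda _ fun i => ?_
      simp only [mix]
      exact Finset.measurable_fun_sum _ fun j _ =>
        ((measurable_pi_apply j).comp hv).fun_const_smul _
    have hg' : Measurable fun ω =>
        (gtState W α G x₁ (fun j s => ξ j s ω) (t + 1)).g := by
      refine measurable_pi_lambda _ fun i => ?_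
      exact (hG i).comp (((measurable_pi_apply i).comp hx).prodMk (hξ i (t + 1) le_rfl))
    have hy' : Measurable fun ω =>
        (gtState W α G x₁ (fun j s => ξ j s ω) (t + 1)).y := hmix ((hy.add hg').sub hg)
    exact ⟨hmix (hx.sub (hy'.fun_const_smul _)), hy', hg'⟩

variable [mΩ : MeasurableSpace Ω] {μ : Measure Ω} [IsProbabilityMeasure μ]

/-- The exponential moment of the noise accumulated by `GT-DSGD` in the first `m` iterations. -/
theorem lintegral_exp_sum_range_le {ξ : ∀ i, ℕ → Ω → Ξ i}
    (W : Matrix (Fin n) (Fin n) ℝ) (α : ℕ → ℝ) {G : ∀ i, Vec d → Ξ i → Vec d}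
    (x₁ : Fin n → Vec d) (hG : ∀ i, Measurable (Function.uncurry (G i)))
    (hξ : ∀ i t, Measurable (ξ i t))
    (hind : iIndepFun (fun (p : Fin n × ℕ) (ω : Ω) => ξ p.1 p.2 ω) μ)
    {X : ℕ → Ω → Fin n → Vec d}
    (hX : ∀ t ω, X t ω = (gtState W α G x₁ (fun j s => ξ j s ω) t).x)
    {Z : ∀ i, (Fin n → Vec d) × Ξ i → Vec d} (hZ : ∀ i, Measurable (Z i))
    {r : Fin n → (Fin n → Vec d) → ℝ} (hr : ∀ i, Measurable (r i)) (hr0 : ∀ i x, 0 ≤ r i x)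
    {u : (Fin n → Vec d) → Vec d} (hu : Measurable u) {σ : Fin n → ℝ} (hσ : ∀ i, 0 < σ i)
    (hZi : ∀ t i, ∀ᵐ ω ∂μ, Integrable (fun ω' => Z i (X t ω, ξ i (t + 1) ω')) μ ∧
      ∫ ω', Z i (X t ω, ξ i (t + 1) ω') ∂μ = 0)
    (hZe : ∀ t i, ∀ᵐ ω ∂μ,
      ∫⁻ ω', ENNReal.ofReal (Real.exp (‖Z i (X t ω, ξ i (t + 1) ω')‖ ^ 2 / σ i ^ 2)) ∂μ ≤
        ENNReal.ofReal (Real.exp (1 + r i (X t ω))))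
    {a b : ℝ} (ha : 0 ≤ a) (hb : 0 ≤ b) (haσ : 96 * a * ∑ i, σ i ^ 2 ≤ 1)
    (hbσ : ∀ i, 2 * (2 * a + b) * σ i ^ 2 ≤ 1)
    {D : ℕ → Ω → ℝ} (hD : ∀ t ω, D t ω =
      inner ℝ (u (X t ω)) (∑ i, Z i (X t ω, ξ i (t + 1) ω))
        + a * ‖∑ i, Z i (X t ω, ξ i (t + 1) ω)‖ ^ 2
        + ∑ i, (b * ‖Z i (X t ω, ξ i (t + 1) ω)‖ ^ 2
          - (3 * ‖u (X t ω)‖ ^ 2 * σ i ^ 2 + (2 * a + b) * σ i ^ 2 + r i (X t ω)))) (m : ℕ) :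
    (∀ t, Measurable (D t)) ∧
    ∫⁻ ω, ENNReal.ofReal (Real.exp (∑ t ∈ Finset.range m, D t ω)) ∂μ ≤ 1 := by
  have hXm : ∀ t (mm : MeasurableSpace Ω), (∀ i, ∀ s ≤ t, Measurable[mm] (ξ i s)) →
      Measurable[mm] (X t) := fun t mm h => by
    have := (measurable_gtState (ξ := ξ) W α x₁ hG t h).1
    rwa [show X t = _ from funext (hX t)]
  have hDm : ∀ t (mm : MeasurableSpace Ω), (∀ i, ∀ s ≤ t + 1, Measurable[mm] (ξ i s)) →
      Measurable[mm] (D t) := fun t mm h => by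
    have hx := hXm t mm fun i s hs => h i s (hs.trans t.le_succ)
    have hz : ∀ i, Measurable fun ω => Z i (X t ω, ξ i (t + 1) ω) := fun i =>
      (hZ i).comp (hx.prodMk (h i (t + 1) le_rfl))
    have hxu : Measurable fun ω => u (X t ω) := hu.comp hx
    have hxr : ∀ i, Measurable fun ω => r i (X t ω) := fun i => (hr i).comp hx
    have aux : ∀ (u' : Ω → Vec d) (z : Fin n → Ω → Vec d) (r' : Fin n → Ω → ℝ),
        Measurable u' → (∀ i, Measurable (z i)) → (∀ i, Measurable (r' i)) →
        Measurable fun ω => inner ℝ (u' ω) (∑ i, z i ω) + a * ‖∑ i, z i ω‖ ^ 2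
          + ∑ i, (b * ‖z i ω‖ ^ 2
            - (3 * ‖u' ω‖ ^ 2 * σ i ^ 2 + (2 * a + b) * σ i ^ 2 + r' i ω)) := by
      intro u' z r' hu' hz' hr'
      fun_prop
    rw [show D t = _ from funext (hD t)]
    exact aux _ _ _ hxu hz hxr
  refine ⟨fun t => hDm t mΩ fun i s _ => hξ i s, ?_⟩
  induction m with
  | zero => simp
  | succ m ih =>
    -- All samples of the past, together with those of the current iteration from the agents in `s`.
    -- Index `m` uses samples of time `m + 1`, so the weight from earlier indices already lies in `A
    -- ∅`.
    let A : Finset (Fin n) → Set (Fin n × ℕ) := fun s => {p | p.2 ≤ m ∨ p.2 = m + 1 ∧ p.1 ∈ s}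
    have hA : Monotone A := fun s s' hs p hp => hp.imp_right fun h => ⟨h.1, hs h.2⟩
    have hpast : ∀ i, ∀ s ≤ m, Measurable[sampleSigma ξ (A ∅)] (ξ i s) := fun i s hs =>
      measurable_sampleSigma ξ (Or.inl hs)
    have hw : Measurable[sampleSigma ξ (A ∅)]
        fun ω => ENNReal.ofReal (Real.exp (∑ t ∈ Finset.range m, D t ω)) := by
      refine ENNReal.measurable_ofReal.comp (Real.measurable_exp.comp
        (Finset.measurable_fun_sum _ fun t ht => ?_))
      exact hDm t _ fun i s hs => hpast i s (hs.trans (Finset.mem_range.1 ht))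
    have h := lintegral_exp_sum_noise_le (μ := μ) (fun s => sampleSigma ξ (A s))
      (fun s => sampleSigma_le hξ _) ((sampleSigma_mono ξ).comp hA) (fun i => hξ i (m + 1))
      (fun s i hi => measurable_sampleSigma ξ (Or.inr ⟨rfl, hi⟩))
      (fun s i hi => indep_sampleSigma hξ hind (by simp [A, hi]))
      (hXm m _ hpast) hw hZ hr hr0 hu hσ (hZi m) (hZe m) ha hb haσ hbσ
    refine le_trans (le_of_eq ?_) (h.trans ih)
    refine lintegral_congr fun ω => ?_
    rw [Finset.sum_range_succ, Real.exp_add, ENNReal.ofReal_mul (Real.exp_pos _).le, hD m ω]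

/-- Markov's inequality for `exp S` at level `1 / δ`. -/
theorem one_sub_le_measureReal_le_log {S : Ω → ℝ} (hS : Measurable S)
    (h : ∫⁻ ω, ENNReal.ofReal (Real.exp (S ω)) ∂μ ≤ 1) {δ : ℝ} (hδ : 0 < δ) :
    1 - δ ≤ μ.real {ω | S ω ≤ Real.log (1 / δ)} := by
  have hms : MeasurableSet {ω | S ω ≤ Real.log (1 / δ)} := measurableSet_le hS measurable_const
  have hM := mul_meas_ge_le_lintegral₀ (μ := μ)
    (f := fun ω => ENNReal.ofReal (Real.exp (S ω))) (by fun_prop) (ENNReal.ofReal (1 / δ))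
  have hsub : {ω | S ω ≤ Real.log (1 / δ)}ᶜ ⊆
      {ω | ENNReal.ofReal (1 / δ) ≤ ENNReal.ofReal (Real.exp (S ω))} := by
    intro ω hω
    simp only [Set.mem_compl_iff, Set.mem_ofPred_eq, not_le] at hω ⊢
    exact ENNReal.ofReal_le_ofReal ((Real.log_lt_iff_lt_exp (by positivity)).1 hω).le
  have h1 : μ {ω | S ω ≤ Real.log (1 / δ)}ᶜ ≤ ENNReal.ofReal δ := by
    have h2 : ENNReal.ofReal (1 / δ) * μ {ω | S ω ≤ Real.log (1 / δ)}ᶜ ≤ 1 :=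
      (mul_le_mul_right (measure_mono hsub) _).trans (hM.trans h)
    calc μ {ω | S ω ≤ Real.log (1 / δ)}ᶜ
        = ENNReal.ofReal δ * (ENNReal.ofReal (1 / δ) * μ {ω | S ω ≤ Real.log (1 / δ)}ᶜ) := by
          rw [← mul_assoc, ← ENNReal.ofReal_mul hδ.le, mul_one_div_cancel hδ.ne']
          simp
      _ ≤ ENNReal.ofReal δ * 1 := by gcongr
      _ = ENNReal.ofReal δ := mul_one _
  have h3 : μ.real {ω | S ω ≤ Real.log (1 / δ)}ᶜ ≤ δ := by
    rw [Measure.real]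
    exact ENNReal.toReal_le_of_le_ofReal hδ.le h1
  rw [probReal_compl_eq_one_sub hms] at h3
  linarith

end History

theorem measurable_model_modelSigma {n d : ℕ} {Ω : Type*} {Ξ : Fin n → Type*}
    {W : Matrix (Fin n) (Fin n) ℝ} {α : ℕ → ℝ} {G : ∀ i, Vec d → Ξ i → Vec d} {x₁ : Fin n → Vec d}
    {ξ : ∀ i, ℕ → Ω → Ξ i} (t : ℕ) (i : Fin n) :
    Measurable[modelSigma W α G x₁ ξ (t + 1)] (model W α G x₁ ξ (t + 1) i) := by
  refine Measurable.of_comap_le ?_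
  exact le_iSup₂_of_le (f := fun s (_ : s ∈ Set.Icc 1 (t + 1)) =>
    ⨆ i, MeasurableSpace.comap (model W α G x₁ ξ s i) inferInstance) (t + 1) (by simp)
    (le_iSup (fun i => MeasurableSpace.comap (model W α G x₁ ξ (t + 1) i) inferInstance) i)

/-- Models of time `t + 1` use samples only up to time `t`. This lag makes the sample of time `t +
1` independent of the σ-algebra in the noise assumptions. -/
theorem modelSigma_le_sampleSigma {n d : ℕ} {Ω : Type*} {Ξ : Fin n → Type*}
    [∀ i, MeasurableSpace (Ξ i)] {W : Matrix (Fin n) (Fin n) ℝ} {α : ℕ → ℝ}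
    {G : ∀ i, Vec d → Ξ i → Vec d} {x₁ : Fin n → Vec d} {ξ : ∀ i, ℕ → Ω → Ξ i}
    (hG : ∀ i, Measurable (Function.uncurry (G i)))
    (t : ℕ) :
    modelSigma W α G x₁ ξ (t + 1) ≤ sampleSigma ξ {p | p.2 ≤ t} := by
  refine iSup₂_le fun s hs => iSup_le fun i => ?_
  have h := (@measurable_gtState n d Ω Ξ _ (sampleSigma ξ {p | p.2 ≤ t}) G ξ W α x₁ hG (s - 1)
    fun j k hk => measurable_sampleSigma ξ (by
      have := hs.2
      exact hk.trans (by omega : s - 1 ≤ t))).1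
  exact (show Measurable[sampleSigma ξ {p | p.2 ≤ t}] (model W α G x₁ ξ s i) from
    (measurable_pi_apply i).comp h).comap_le

/-! ### The noise assumptions at a frozen model. -/

section Conditional

variable {n d : ℕ} {Ω : Type*} [mΩ : MeasurableSpace Ω] {μ : Measure Ω}
  {Ξ : Fin n → Type*} [∀ i, MeasurableSpace (Ξ i)] {W : Matrix (Fin n) (Fin n) ℝ} {α : ℕ → ℝ}
  {G : ∀ i, Vec d → Ξ i → Vec d} {x₁ : Fin n → Vec d} {ξ : ∀ i, ℕ → Ω → Ξ i}

variable {f : Fin n → Vec d → ℝ}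

theorem indep_modelSigma_sample (hG : ∀ i, Measurable (Function.uncurry (G i)))
    (hξ : ∀ i t, Measurable (ξ i t))
    (hind : iIndepFun (fun (p : Fin n × ℕ) (ω : Ω) => ξ p.1 p.2 ω) μ) (t : ℕ) (i : Fin n) :
    Indep (modelSigma W α G x₁ ξ (t + 1))
      (MeasurableSpace.comap (ξ i (t + 1)) inferInstance) μ :=
  indep_of_indep_of_le_left (indep_sampleSigma hξ hind (by simp)) (modelSigma_le_sampleSigma hG t)

variable [IsProbabilityMeasure μ]

theorem CondZeroMean.ae_integral_eq_zero (hG : ∀ i, Measurable (Function.uncurry (G i)))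
    (hξ : ∀ i t, Measurable (ξ i t))
    (hind : iIndepFun (fun (p : Fin n × ℕ) (ω : Ω) => ξ p.1 p.2 ω) μ)
    (hf : ∀ i, Measurable (gradient (f i))) {t : ℕ} {i : Fin n}
    (h : CondZeroMean μ (modelSigma W α G x₁ ξ (t + 1)) (noise W α G x₁ ξ f (t + 1) i)) :
    ∀ᵐ ω ∂μ, Integrable (fun ω' => G i (model W α G x₁ ξ (t + 1) i ω) (ξ i (t + 1) ω')
        - gradient (f i) (model W α G x₁ ξ (t + 1) i ω)) μ ∧
      ∫ ω', (G i (model W α G x₁ ξ (t + 1) i ω) (ξ i (t + 1) ω')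
        - gradient (f i) (model W α G x₁ ξ (t + 1) i ω)) ∂μ = 0 :=
  ae_integral_eq_zero_of_condExp_eq_zero
    ((modelSigma_le_sampleSigma hG t).trans (sampleSigma_le hξ _))
    (measurable_model_modelSigma t i) (hξ i (t + 1)) (indep_modelSigma_sample hG hξ hind t i)
    (φ := fun p => G i p.1 p.2 - gradient (f i) p.1)
    ((hG i).sub ((hf i).comp measurable_fst)) h.1 h.2

theorem RelaxedSubGaussian.ae_lintegral_le (hG : ∀ i, Measurable (Function.uncurry (G i)))
    (hξ : ∀ i t, Measurable (ξ i t))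
    (hind : iIndepFun (fun (p : Fin n × ℕ) (ω : Ω) => ξ p.1 p.2 ω) μ)
    (hf : ∀ i, Measurable (gradient (f i))) {V : Vec d → Vec d} (hV : Measurable V)
    {t : ℕ} {i : Fin n} {s ρ : ℝ}
    (h : RelaxedSubGaussian μ (modelSigma W α G x₁ ξ (t + 1)) (noise W α G x₁ ξ f (t + 1) i)
      (fun ω => V (model W α G x₁ ξ (t + 1) i ω)) s ρ) :
    ∀ᵐ ω ∂μ, ∫⁻ ω', ENNReal.ofReal (Real.exp
        (‖G i (model W α G x₁ ξ (t + 1) i ω) (ξ i (t + 1) ω')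
          - gradient (f i) (model W α G x₁ ξ (t + 1) i ω)‖ ^ 2 / s ^ 2)) ∂μ ≤
      ENNReal.ofReal (Real.exp (1 + ρ * ‖V (model W α G x₁ ξ (t + 1) i ω)‖)) := by
  have hm : Measurable fun p : Vec d × Ξ i => G i p.1 p.2 - gradient (f i) p.1 :=
    (hG i).sub ((hf i).comp measurable_fst)
  exact ae_lintegral_le_of_condLExp_le
    ((modelSigma_le_sampleSigma hG t).trans (sampleSigma_le hξ _))
    (measurable_model_modelSigma t i) (hξ i (t + 1)) (indep_modelSigma_sample hG hξ hind t i)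
    (φ := fun p => ENNReal.ofReal (Real.exp (‖G i p.1 p.2 - gradient (f i) p.1‖ ^ 2 / s ^ 2)))
    (b := fun x => ENNReal.ofReal (Real.exp (1 + ρ * ‖V x‖)))
    (ENNReal.measurable_ofReal.comp (Real.measurable_exp.comp ((hm.norm.pow_const 2).div_const _)))
    (by fun_prop) h

end Conditional

/-! ### Consequences of the step-size threshold and the final rate. -/

namespace StepThreshold

variable {n d : ℕ} {l L s sm ρ ε C α : ℝ}

theorem sq_lt_one (h : StepThreshold n d l L s sm ρ ε C) (hl : 0 ≤ l) (hL : 0 < L) (hC : 0 < C) :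
    l ^ 2 < 1 := by
  rcases hl.eq_or_lt with rfl | hl
  · norm_num
  · have : 0 < C * (4 * l * L * (12 : ℝ) ^ (1 / 4 : ℝ)) := by positivity
    linarith [h.quarter]

theorem consensus_sq (h : StepThreshold n d l L s sm ρ ε C) (hL : 0 < L) (hα0 : 0 ≤ α)
    (hα : α ≤ C) : 768 * α ^ 2 * L ^ 2 * l ^ 4 ≤ (1 - l ^ 2) ^ 4 := by
  have h1 : α * (16 * l ^ 2 * L * √3) ≤ (1 - l ^ 2) ^ 2 :=
    (mul_le_mul_of_nonneg_right hα (by positivity)).trans h.consensus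
  have h2 := pow_le_pow_left₀ (by positivity) h1 2
  have h3 : √3 ^ 2 = (3 : ℝ) := Real.sq_sqrt (by norm_num)
  calc 768 * α ^ 2 * L ^ 2 * l ^ 4 = (α * (16 * l ^ 2 * L * √3)) ^ 2 := by
        rw [mul_pow, mul_pow, h3]; ring
    _ ≤ ((1 - l ^ 2) ^ 2) ^ 2 := h2
    _ = _ := by ring

/-- Cubing clears the fractional exponents. -/
theorem noiseMax_cube (h : StepThreshold n d l L s sm ρ ε C) (hl : 0 ≤ l) (hl1 : l ^ 2 ≤ 1)
    (hL : 0 < L) (hs : 0 ≤ sm) (hα0 : 0 ≤ α) (hα : α ≤ C) :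
    1614 * α ^ 3 * L ^ 2 * l ^ 4 * sm ≤ n * (1 - l ^ 2) ^ 4 := by
  have h1 := (mul_le_mul_of_nonneg_right hα (by positivity)).trans h.noiseMax
  have h2 := pow_le_pow_left₀ (by positivity) h1 3
  have e : ∀ (y : ℝ), 0 ≤ y → ∀ p : ℝ, (y ^ p) ^ 3 = y ^ (p * 3) := by
    intro y hy p
    rw [← Real.rpow_natCast, ← Real.rpow_mul hy]
    norm_num
  have hm : 0 ≤ 1 - l ^ 2 := by linarith
  simp only [mul_pow] at h2
  rw [e l hl, e sm hs, e L hL.le, e 1614 (by norm_num), e n (by positivity), e _ hm] at h2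
  norm_num at h2
  linarith

theorem mul_smooth_le (h : StepThreshold n d l L s sm ρ ε C) (hL : 0 < L) (hα : α ≤ C) :
    α * L ≤ 1 / 4 := by
  have := hα.trans h.smooth
  rw [le_div_iff₀ (by positivity)] at this
  linarith

theorem mul_noiseAvg_le (h : StepThreshold n d l L s sm ρ ε C) (hs : 0 < s) (hα : α ≤ C) :
    9 * α * s ≤ n := by
  have := hα.trans h.noiseAvg
  rw [le_div_iff₀ (by positivity)] at this
  linarith

theorem sq_mul_dimension_le (h : StepThreshold n d l L s sm ρ ε C) (hL : 0 < L) (hs : 0 < s)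
    (hd : 1 ≤ d) (hα0 : 0 ≤ α) (hα : α ≤ C) : 282 * (α ^ 2 * L * s) ≤ n := by
  have hd' : (1 : ℝ) ≤ d := by exact_mod_cast hd
  have h1 := pow_le_pow_left₀ hα0 (hα.trans h.dimension) 2
  have he : (1 : ℝ) ≤ Real.exp 1 := by linarith [Real.add_one_le_exp 1]
  rw [Real.sq_sqrt (by positivity), le_div_iff₀ (by positivity)] at h1
  have h0 : 0 ≤ α ^ 2 * L * s := by positivity
  have h2 : 1 ≤ Real.exp 1 * d := one_le_mul_of_one_le_of_one_le he hd'
  nlinarith [mul_le_mul_of_nonneg_left h2 h0]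

theorem rpow_relaxed_le (h : StepThreshold n d l L s sm ρ ε C) (hρ : 0 ≤ ρ) (hε : 0 < ε)
    (hα0 : 0 ≤ α) (hα : α ≤ C) : α ^ (1 + ε) * ρ * (16 * n) ≤ 1 := by
  refine le_trans ?_ h.relaxedPow
  have : α ^ (1 + ε) ≤ C ^ (1 + ε) := Real.rpow_le_rpow hα0 hα (by linarith)
  calc α ^ (1 + ε) * ρ * (16 * n) = α ^ (1 + ε) * (16 * n * ρ) := by ring
    _ ≤ _ := by gcongr

end StepThreshold

theorem rate_arith {N T C α L s ρ ε l B ℓ dX dG SD : ℝ} (hN : 0 < N) (hT : 0 < T) (hC : 0 < C)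
    (hL : 0 < L) (hs : 0 ≤ s) (hρ : 0 ≤ ρ) (hε : 0 < ε) (hl : l ^ 2 < 1) (hB : 0 ≤ B)
    (hℓ : 0 ≤ ℓ) (hdX : 0 ≤ dX) (hdG : 0 ≤ dG) (hα : α = min (√N / √T) C)
    (h : 5 / 96 * α * SD ≤ B + T * (4 * α ^ 2 * L * s / N
        + 120 * (α ^ 3 * L ^ 2 * l ^ 4 / (1 - l ^ 2) ^ 4) * s + α * (N * (α ^ (1 + ε) * ρ) / 2))
      + 4 / 5 * α * L ^ 2 * (2 * dX / (1 - l ^ 2)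
        + 16 * α ^ 2 * l ^ 4 * dG / (1 - l ^ 2) ^ 3)) :
    SD / T ≤ 2304 * ((B + s * L * (1 + ℓ)) / √(N * T)
      + N ^ ((3 + ε) / 2) * ρ / T ^ ((1 + ε) / 2) + B / (C * T)
      + L ^ 2 * dX / ((1 - l ^ 2) * T) + N * s * l ^ 4 * L ^ 2 / ((1 - l ^ 2) ^ 4 * T)
      + N * L ^ 2 * dG / ((1 - l ^ 2) ^ 3 * T ^ 2)) := by
  have hu : 0 < 1 - l ^ 2 := by linarith
  have hl4 : l ^ 4 ≤ 1 := by
    have : l ^ 4 = (l ^ 2) ^ 2 := by ring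
    rw [this]; exact pow_le_one₀ (sq_nonneg l) hl.le
  set u := 1 - l ^ 2
  have hsN : 0 < √N := Real.sqrt_pos.2 hN
  have hsT : 0 < √T := Real.sqrt_pos.2 hT
  have hα0 : 0 < α := by rw [hα]; exact lt_min (by positivity) hC
  have hα1 : α ≤ √N / √T := by rw [hα]; exact min_le_left _ _
  have hNN : √N * √N = N := Real.mul_self_sqrt hN.le
  have hTT : √T * √T = T := Real.mul_self_sqrt hT.le
  have hNT : √(N * T) = √N * √T := Real.sqrt_mul hN.le T
  -- The only place where `α` must not be small: whichever branch attains the minimum supplies one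
  -- of the two summands. The other estimates use only `α ≤ √N / √T`.
  have f1 : 1 / (α * T) ≤ 1 / √(N * T) + 1 / (C * T) := by
    rcases min_choice (√N / √T) C with hm | hm
    · have : 1 / (α * T) = 1 / √(N * T) := by
        rw [hα, hm, hNT]
        congr 1
        rw [div_mul_eq_mul_div, div_eq_iff hsT.ne', mul_assoc, hTT]
      rw [this]
      have : 0 ≤ 1 / (C * T) := by positivity
      linarith
    · rw [hα, hm]
      have : 0 ≤ 1 / √(N * T) := by positivity
      linarith
  have f2 : α / N ≤ 1 / √(N * T) := by
    rw [hNT, div_le_div_iff₀ hN (by positivity)]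
    calc α * (√N * √T) ≤ √N / √T * (√N * √T) := by gcongr
      _ = 1 * N := by field_simp; linarith
  have f3 : α ^ 2 ≤ N / T := by
    have := pow_le_pow_left₀ hα0.le hα1 2
    rwa [div_pow, Real.sq_sqrt hN.le, Real.sq_sqrt hT.le] at this
  have f4 : N * α ^ (1 + ε) ≤ N ^ ((3 + ε) / 2) / T ^ ((1 + ε) / 2) := by
    have h1 : α ^ (1 + ε) ≤ (√N / √T) ^ (1 + ε) :=
      Real.rpow_le_rpow hα0.le hα1 (by linarith)
    have h2 : ∀ y : ℝ, 0 < y → √y ^ (1 + ε) = y ^ ((1 + ε) / 2) := by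
      intro y hy
      rw [Real.sqrt_eq_rpow, ← Real.rpow_mul hy.le]
      congr 1; ring
    rw [Real.div_rpow hsN.le hsT.le, h2 N hN, h2 T hT] at h1
    have h3 : N ^ ((3 + ε) / 2) = N * N ^ ((1 + ε) / 2) := by
      rw [show (3 + ε) / 2 = 1 + (1 + ε) / 2 by ring, Real.rpow_add hN, Real.rpow_one]
    rw [h3, mul_div_assoc]
    gcongr
  have hmain : SD / T ≤ 96 / 5 * (B * (1 / (α * T)) + 4 * L * s * (α / N)
      + 120 * (L ^ 2 * l ^ 4 / u ^ 4 * s) * α ^ 2 + ρ / 2 * (N * α ^ (1 + ε))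
      + 8 / 5 * (L ^ 2 * dX / (u * T))
      + 64 / 5 * (L ^ 2 * dG / (u ^ 3 * T)) * (l ^ 4 * α ^ 2)) := by
    have hpos : 0 < 5 / 96 * α := by positivity
    rw [mul_comm, ← le_div_iff₀ hpos] at h
    have h' := div_le_div_of_nonneg_right h hT.le
    refine h'.trans_eq ?_
    field_simp
    ring
  refine hmain.trans ?_
  have g1 : B * (1 / (α * T)) ≤ B * (1 / √(N * T) + 1 / (C * T)) := by gcongr
  have g2 : 4 * L * s * (α / N) ≤ 4 * L * s * (1 / √(N * T)) := by gcongr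
  have g3 : 120 * (L ^ 2 * l ^ 4 / u ^ 4 * s) * α ^ 2 ≤
      120 * (L ^ 2 * l ^ 4 / u ^ 4 * s) * (N / T) := by gcongr
  have g4 : ρ / 2 * (N * α ^ (1 + ε)) ≤ ρ / 2 * (N ^ ((3 + ε) / 2) / T ^ ((1 + ε) / 2)) := by
    gcongr
  have g5 : 64 / 5 * (L ^ 2 * dG / (u ^ 3 * T)) * (l ^ 4 * α ^ 2) ≤
      64 / 5 * (L ^ 2 * dG / (u ^ 3 * T)) * (1 * (N / T)) := by gcongr
  have p1 : 0 ≤ B / √(N * T) := by positivity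
  have p2 : 0 ≤ s * L / √(N * T) := by positivity
  have p2' : 0 ≤ s * L * ℓ / √(N * T) := by positivity
  have p3 : 0 ≤ N ^ ((3 + ε) / 2) * ρ / T ^ ((1 + ε) / 2) := by positivity
  have p4 : 0 ≤ B / (C * T) := by positivity
  have p5 : 0 ≤ L ^ 2 * dX / (u * T) := by positivity
  have p6 : 0 ≤ N * s * l ^ 4 * L ^ 2 / (u ^ 4 * T) := by positivity
  have p7 : 0 ≤ N * L ^ 2 * dG / (u ^ 3 * T ^ 2) := by positivity
  have e1 : B * (1 / √(N * T) + 1 / (C * T)) = B / √(N * T) + B / (C * T) := by ring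
  have e2 : 4 * L * s * (1 / √(N * T)) = 4 * (s * L / √(N * T)) := by ring
  have e3 : 120 * (L ^ 2 * l ^ 4 / u ^ 4 * s) * (N / T) =
      120 * (N * s * l ^ 4 * L ^ 2 / (u ^ 4 * T)) := by field_simp
  have e4 : ρ / 2 * (N ^ ((3 + ε) / 2) / T ^ ((1 + ε) / 2)) =
      1 / 2 * (N ^ ((3 + ε) / 2) * ρ / T ^ ((1 + ε) / 2)) := by ring
  have e5 : 64 / 5 * (L ^ 2 * dG / (u ^ 3 * T)) * (1 * (N / T)) =
      64 / 5 * (N * L ^ 2 * dG / (u ^ 3 * T ^ 2)) := by field_simp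
  have e6 : (B + s * L * (1 + ℓ)) / √(N * T) =
      B / √(N * T) + s * L / √(N * T) + s * L * ℓ / √(N * T) := by ring
  rw [e6]
  linarith

theorem sum_range_add_le_of_forall_add_le {D B A E : ℕ → ℝ} {c : ℝ} (m : ℕ)
    (h : ∀ t, D t + B t ≤ A t + E t + c) :
    ∑ t ∈ Finset.range m, D t + ∑ t ∈ Finset.range m, B t ≤
      ∑ t ∈ Finset.range m, A t + ∑ t ∈ Finset.range m, E t + m * c := by
  have := Finset.sum_le_sum fun t (_ : t ∈ Finset.range m) => h t
  simpa [Finset.sum_add_distrib] using this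

theorem norm_sq_gradient_le_two_mul {V : Type*} [NormedAddCommGroup V] [InnerProductSpace ℝ V]
    [CompleteSpace V] {f : V → ℝ} {L : ℝ}
    (hL : ∀ x y, ‖gradient f x - gradient f y‖ ≤ L * ‖x - y‖) (x y : V) :
    ‖gradient f x‖ ^ 2 ≤ 2 * ‖gradient f y‖ ^ 2 + 2 * L ^ 2 * ‖x - y‖ ^ 2 := by
  have h1 := norm_add_sq_le_two_mul (gradient f y) (gradient f x - gradient f y)
  rw [add_sub_cancel] at h1
  have h2 := pow_le_pow_left₀ (norm_nonneg _) (hL x y) 2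
  rw [mul_pow] at h2
  linarith

/-- The price of the compensator. `9 * α * s ≤ N` reduces the variance of the linear form to `α / 3
* g ^ 2`. The relaxed part uses `c ≤ 1 / 2 + c ^ 2 / 2`; the factor `16 * N` in `hαρ` then limits
its quadratic half to weight `α / 32`. -/
theorem noise_arith {N α L Q s ε ρ : ℝ} (hN : 0 < N) (hα0 : 0 < α) (hαs : 9 * α * s ≤ N)
    (hρ : 0 ≤ ρ) (hαρ : α ^ (1 + ε) * ρ * (16 * N) ≤ 1) {ι : Type*} [Fintype ι]
    (hcard : (Fintype.card ι : ℝ) = N) {σ : ι → ℝ} (hσ : ∑ i, σ i ^ 2 = N * s)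
    (g : ℝ) (c : ι → ℝ) :
    ∑ i, (3 * (α / N * g) ^ 2 * σ i ^ 2
        + (2 * (2 * α ^ 2 * L / N ^ 2) + 120 * Q / N) * σ i ^ 2 + α ^ (2 + ε) * ρ * c i) ≤
      α / 3 * g ^ 2 + (4 * α ^ 2 * L * s / N + 120 * Q * s + α * (N * (α ^ (1 + ε) * ρ) / 2))
      + α / 32 * (N⁻¹ * ∑ i, c i ^ 2) := by
  have hpow : α ^ (2 + ε) = α * α ^ (1 + ε) := by
    rw [show 2 + ε = 1 + (1 + ε) by ring, Real.rpow_add hα0, Real.rpow_one]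
  have hk0 : 0 ≤ α ^ (1 + ε) * ρ := by positivity
  rw [Finset.sum_add_distrib, Finset.sum_add_distrib, ← Finset.mul_sum, ← Finset.mul_sum,
    ← Finset.mul_sum, hσ, hpow]
  generalize α ^ (1 + ε) = k at *
  have h1 : 3 * (α / N * g) ^ 2 * (N * s) ≤ α / 3 * g ^ 2 := by
    have e : 3 * (α / N * g) ^ 2 * (N * s) = α * g ^ 2 / 3 * (9 * α * s / N) := by
      field_simp; ring
    have h2 : 9 * α * s / N ≤ 1 := (div_le_one hN).2 hαs
    rw [e]
    calc α * g ^ 2 / 3 * (9 * α * s / N) ≤ α * g ^ 2 / 3 * 1 := by gcongr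
      _ = _ := by ring
  have h2 : (2 * (2 * α ^ 2 * L / N ^ 2) + 120 * Q / N) * (N * s) =
      4 * α ^ 2 * L * s / N + 120 * Q * s := by
    field_simp; ring
  have h3 : ∑ i, c i ≤ N / 2 + (∑ i, c i ^ 2) / 2 := by
    have : ∑ i, c i ≤ ∑ i, (1 / 2 + c i ^ 2 / 2) :=
      Finset.sum_le_sum fun i _ => by nlinarith [sq_nonneg (c i - 1)]
    refine this.trans_eq ?_
    rw [Finset.sum_add_distrib, Finset.sum_const, nsmul_eq_mul, Finset.card_univ, hcard,
      Finset.sum_div]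
    ring
  have h4 : k * ρ * (∑ i, c i ^ 2) / 2 ≤ 1 / 32 * (N⁻¹ * ∑ i, c i ^ 2) := by
    have h5 : k * ρ ≤ 1 / (16 * N) := (le_div_iff₀ (by positivity)).2 hαρ
    calc k * ρ * (∑ i, c i ^ 2) / 2 ≤ 1 / (16 * N) * (∑ i, c i ^ 2) / 2 := by gcongr
      _ = _ := by field_simp; ring
  have h5 : α * (k * ρ * ∑ i, c i) ≤
      α * (k * ρ * N / 2 + 1 / 32 * (N⁻¹ * ∑ i, c i ^ 2)) := by
    gcongr
    nlinarith [mul_le_mul_of_nonneg_left h3 hk0]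
  rw [h2]
  linarith

/-! ### Absorbing the compensator into the pathwise bound. -/

namespace IsGTRun

variable {n d : ℕ} {W : Matrix (Fin n) (Fin n) ℝ} {α : ℝ} {x y g : ℕ → Fin n → Vec d}
  {f : Fin n → Vec d → ℝ} {L : ℝ}

theorem sum_norm_sq_local_gradient_le (h : IsGTRun W α x y g) (hn : 0 < n)
    (hW : W ∈ doublyStochastic ℝ (Fin n)) (hl : connectivity W ^ 2 < 1) (hL0 : 0 ≤ L)
    (hf : ∀ i, Differentiable ℝ (f i))
    (hL : ∀ i x y, ‖gradient (f i) x - gradient (f i) y‖ ≤ L * ‖x - y‖)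
    (hbdd : BddBelow (Set.range (globalCost f)))
    (hα0 : 0 < α) (hαL : α * L ≤ 1 / 4)
    (hα : 768 * α ^ 2 * L ^ 2 * connectivity W ^ 4 ≤ (1 - connectivity W ^ 2) ^ 4)
    {σ : Fin n → ℝ} {ε ρ : ℝ} (hρ : 0 ≤ ρ) (hαs : 9 * α * avgSq σ ≤ n)
    (hαρ : α ^ (1 + ε) * ρ * (16 * n) ≤ 1) (m : ℕ) {Q Λ : ℝ}
    (hQ : Q = α ^ 3 * L ^ 2 * connectivity W ^ 4 / (1 - connectivity W ^ 2) ^ 4)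
    (hΛ : ∑ t ∈ Finset.range (m + 1),
      (inner ℝ ((-(α / n)) • gradient (globalCost f) (agentMean (x t)))
          (∑ i, (g t i - gradient (f i) (x t i)))
        + 2 * α ^ 2 * L / n ^ 2 * ‖∑ i, (g t i - gradient (f i) (x t i))‖ ^ 2
        + ∑ i, (120 * Q / n * ‖g t i - gradient (f i) (x t i)‖ ^ 2
          - (3 * ‖(-(α / n)) • gradient (globalCost f) (agentMean (x t))‖ ^ 2 * σ i ^ 2
            + (2 * (2 * α ^ 2 * L / n ^ 2) + 120 * Q / n) * σ i ^ 2
            + α ^ (2 + ε) * ρ * ‖gradient (globalCost f) (x t i)‖))) ≤ Λ) :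
    ∑ t ∈ Finset.range (m + 1), 5 / 96 * α *
        ((n : ℝ)⁻¹ * ∑ i, ‖gradient (globalCost f) (x t i)‖ ^ 2) ≤
      Λ + deltaF f (x 0) + (m + 1 : ℕ) * (4 * α ^ 2 * L * avgSq σ / n + 120 * Q * avgSq σ
          + α * (n * (α ^ (1 + ε) * ρ) / 2))
      + 4 / 5 * α * L ^ 2 * (2 * deltaX (x 0) / (1 - connectivity W ^ 2)
        + 16 * α ^ 2 * connectivity W ^ 4 * deltaG f (x 0) / (1 - connectivity W ^ 2) ^ 3) := by
  have hn' : (0 : ℝ) < n := by positivity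
  have hσ : ∑ i, σ i ^ 2 = n * avgSq σ := by
    simp [avgSq, agentMean, hn'.ne']
  have hlip := norm_gradient_globalCost_sub_le hn hf hL
  have hpath := h.sum_norm_sq_gradient_le hn hW hl hL0 hf hL hbdd hα0.le hαL hα m
  rw [← hQ] at hpath
  have hnorm : ∀ t, ‖(-(α / n)) • gradient (globalCost f) (agentMean (x t))‖ =
      α / n * ‖gradient (globalCost f) (agentMean (x t))‖ := fun t => by
    rw [norm_smul, norm_neg, Real.norm_of_nonneg (by positivity)]
  have hlin : ∀ t, inner ℝ ((-(α / n)) • gradient (globalCost f) (agentMean (x t)))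
        (∑ i, (g t i - gradient (f i) (x t i)))
      + 2 * α ^ 2 * L / n ^ 2 * ‖∑ i, (g t i - gradient (f i) (x t i))‖ ^ 2 =
      -α * inner ℝ (gradient (globalCost f) (agentMean (x t)))
          (agentMean fun i => g t i - gradient (f i) (x t i))
        + 2 * α ^ 2 * L * ‖agentMean fun i => g t i - gradient (f i) (x t i)‖ ^ 2 := fun t => by
    rw [sum_eq_smul_agentMean hn, real_inner_smul_left, real_inner_smul_right, norm_smul,
      mul_pow, Real.norm_natCast]
    field_simp
  have hstep : ∀ t, 1 / 12 * α * ((n : ℝ)⁻¹ * ∑ i, ‖gradient (globalCost f) (x t i)‖ ^ 2) ≤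
      α / 6 * ‖gradient (globalCost f) (agentMean (x t))‖ ^ 2
      + α * L ^ 2 / (6 * n) * ∑ i, ‖agentDev (x t) i‖ ^ 2 := fun t => by
    have h1 : ∑ i, ‖gradient (globalCost f) (x t i)‖ ^ 2 ≤
        ∑ i, (2 * ‖gradient (globalCost f) (agentMean (x t))‖ ^ 2
          + 2 * L ^ 2 * ‖agentDev (x t) i‖ ^ 2) :=
      Finset.sum_le_sum fun i _ => norm_sq_gradient_le_two_mul hlip _ _
    rw [Finset.sum_add_distrib, Finset.sum_const, Finset.card_univ, Fintype.card_fin,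
      nsmul_eq_mul, ← Finset.mul_sum] at h1
    calc _ ≤ 1 / 12 * α * ((n : ℝ)⁻¹ *
          (n * (2 * ‖gradient (globalCost f) (agentMean (x t))‖ ^ 2)
            + 2 * L ^ 2 * ∑ i, ‖agentDev (x t) i‖ ^ 2)) := by gcongr
      _ = _ := by field_simp; ring
  have hno := fun t => noise_arith (L := L) (Q := Q) hn' hα0 hαs hρ hαρ
    (by rw [Fintype.card_fin]) hσ
    ‖gradient (globalCost f) (agentMean (x t))‖ fun i => ‖gradient (globalCost f) (x t i)‖
  -- Of the weight `α / 2` on the gradient at the mean, `α / 3` pays for the linear noise. The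
  -- remaining `α / 6`, with the reserved consensus term, dominates `α / 12` of the averaged local
  -- squares. Subtracting the relaxed cost gives `1 / 12 - 1 / 32 = 5 / 96`.
  have hsum := sum_range_add_le_of_forall_add_le (m + 1) fun t =>
    (show 5 / 96 * α * ((n : ℝ)⁻¹ * ∑ i, ‖gradient (globalCost f) (x t i)‖ ^ 2)
      + (-α * inner ℝ (gradient (globalCost f) (agentMean (x t)))
            (agentMean fun i => g t i - gradient (f i) (x t i))
          + 2 * α ^ 2 * L * ‖agentMean fun i => g t i - gradient (f i) (x t i)‖ ^ 2
          + 120 * Q / n * ∑ i, ‖g t i - gradient (f i) (x t i)‖ ^ 2) ≤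
      (α / 2 * ‖gradient (globalCost f) (agentMean (x t))‖ ^ 2
        + α * L ^ 2 / (6 * n) * ∑ i, ‖agentDev (x t) i‖ ^ 2)
      + (inner ℝ ((-(α / n)) • gradient (globalCost f) (agentMean (x t)))
          (∑ i, (g t i - gradient (f i) (x t i)))
        + 2 * α ^ 2 * L / n ^ 2 * ‖∑ i, (g t i - gradient (f i) (x t i))‖ ^ 2
        + ∑ i, (120 * Q / n * ‖g t i - gradient (f i) (x t i)‖ ^ 2
          - (3 * ‖(-(α / n)) • gradient (globalCost f) (agentMean (x t))‖ ^ 2 * σ i ^ 2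
            + (2 * (2 * α ^ 2 * L / n ^ 2) + 120 * Q / n) * σ i ^ 2
            + α ^ (2 + ε) * ρ * ‖gradient (globalCost f) (x t i)‖)))
      + (4 * α ^ 2 * L * avgSq σ / n + 120 * Q * avgSq σ
          + α * (n * (α ^ (1 + ε) * ρ) / 2)) by
        rw [hlin, hnorm, Finset.sum_sub_distrib, ← Finset.mul_sum]
        linarith [hstep t, hno t])
  linarith

end IsGTRun

/-! ### Assembly of the high-probability bound. -/

theorem continuous_of_forall_norm_sub_le {V V' : Type*} [SeminormedAddCommGroup V]
    [SeminormedAddCommGroup V'] {g : V → V'} {L : ℝ} (h : ∀ x y, ‖g x - g y‖ ≤ L * ‖x - y‖) :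
    Continuous g :=
  (LipschitzWith.of_dist_le_mul (K := L.toNNReal) fun x y => by
    rw [dist_eq_norm, dist_eq_norm]
    exact (h x y).trans (by gcongr; exact Real.le_coe_toNNReal L)).continuous

theorem measurable_agentMean {n d : ℕ} : Measurable (agentMean : (Fin n → Vec d) → Vec d) := by
  unfold agentMean
  fun_prop

theorem sq_le_maxSq {n : ℕ} (σ : Fin n → ℝ) (i : Fin n) : σ i ^ 2 ≤ maxSq σ :=
  le_ciSup (f := fun i => σ i ^ 2) (Set.finite_range _).bddAbove i

theorem noise_weight_bounds {N α L s sm si u l : ℝ} (hN : 1 ≤ N) (hL : 0 ≤ L) (hα : 0 ≤ α)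
    (hu : 0 < u) (hsis : si ≤ N * s) (hsm : si ≤ sm)
    (hdim : 282 * (α ^ 2 * L * s) ≤ N)
    (hmax : 1614 * α ^ 3 * L ^ 2 * l ^ 4 * sm ≤ N * u ^ 4) :
    96 * (2 * α ^ 2 * L / N ^ 2) * (N * s) ≤ 1 ∧
    2 * (2 * (2 * α ^ 2 * L / N ^ 2) + 120 * (α ^ 3 * L ^ 2 * l ^ 4 / u ^ 4) / N) * si ≤ 1 := by
  have hN0 : 0 < N := by linarith
  have h1 : 96 * (2 * α ^ 2 * L / N ^ 2) * (N * s) ≤ 192 / 282 := by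
    have e : 96 * (2 * α ^ 2 * L / N ^ 2) * (N * s) = 192 / 282 * (282 * (α ^ 2 * L * s) / N) := by
      field_simp; ring
    have : 282 * (α ^ 2 * L * s) / N ≤ 1 := (div_le_one hN0).2 hdim
    rw [e]; linarith
  have h2 : 96 * (2 * α ^ 2 * L / N ^ 2) * si ≤ 96 * (2 * α ^ 2 * L / N ^ 2) * (N * s) := by
    gcongr
  have h3 : α ^ 3 * L ^ 2 * l ^ 4 / u ^ 4 / N * si ≤ 1 / 1614 := by
    calc α ^ 3 * L ^ 2 * l ^ 4 / u ^ 4 / N * si ≤ α ^ 3 * L ^ 2 * l ^ 4 / u ^ 4 / N * sm := by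
          gcongr
      _ = 1 / 1614 * (1614 * α ^ 3 * L ^ 2 * l ^ 4 * sm / (N * u ^ 4)) := by field_simp
      _ ≤ 1 / 1614 * 1 := by
          gcongr
          exact (div_le_one (by positivity)).2 hmax
      _ = _ := mul_one _
  refine ⟨by linarith, ?_⟩
  have e : 2 * (2 * (2 * α ^ 2 * L / N ^ 2) + 120 * (α ^ 3 * L ^ 2 * l ^ 4 / u ^ 4) / N) * si =
      4 / 96 * (96 * (2 * α ^ 2 * L / N ^ 2) * si)
        + 240 * (α ^ 3 * L ^ 2 * l ^ 4 / u ^ 4 / N * si) := by ring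
  rw [e]; linarith

theorem mainTheorem1 :
    ∃ K : ℝ, 0 < K ∧
      ∀ (n d : ℕ), 2 ≤ n → 1 ≤ d →
      -- the network
      ∀ (W : Matrix (Fin n) (Fin n) ℝ), W.IsPrimitive → W ∈ doublyStochastic ℝ (Fin n) →
      -- the costs
      ∀ (f : Fin n → Vec d → ℝ) (L : ℝ), 0 < L →
        (∀ i, Differentiable ℝ (f i)) →
        (∀ i x y, ‖gradient (f i) x - gradient (f i) y‖ ≤ L * ‖x - y‖) →
        BddBelow (Set.range (globalCost f)) →
      -- the oracles and the random samples
      ∀ (Ω : Type*) [MeasurableSpace Ω] (μ : Measure Ω) [IsProbabilityMeasure μ]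
        (Ξ : Fin n → Type*) [∀ i, MeasurableSpace (Ξ i)]
        (G : ∀ i, Vec d → Ξ i → Vec d) (ξ : ∀ i, ℕ → Ω → Ξ i),
        (∀ i, Measurable (Function.uncurry (G i))) →
        (∀ i t, Measurable (ξ i t)) →
        iIndepFun (fun (p : Fin n × ℕ) (ω : Ω) => ξ p.1 p.2 ω) μ →
      -- the initial models and the constant step-size
      ∀ (x₁ : Fin n → Vec d) (σ : Fin n → ℝ) (ρ ε C α : ℝ) (T : ℕ),
        (∀ i, 0 < σ i) → 0 ≤ ρ → 0 < ε → 2 ≤ T →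
        0 < C →
        StepThreshold n d (connectivity W) L (avgSq σ) (maxSq σ) ρ ε C →
        α = min (√n / √T) C →
      -- the noise
        (∀ t, 1 ≤ t → ∀ i,
          CondZeroMean μ (modelSigma W (fun _ => α) G x₁ ξ t)
            (noise W (fun _ => α) G x₁ ξ f t i)) →
        (∀ t, 1 ≤ t → ∀ i,
          RelaxedSubGaussian μ (modelSigma W (fun _ => α) G x₁ ξ t)
            (noise W (fun _ => α) G x₁ ξ f t i)
            (fun ω => gradient (globalCost f) (model W (fun _ => α) G x₁ ξ t i ω))
            (σ i) (α ^ (2 + ε) * ρ)) →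
      ∀ δ : ℝ, 0 < δ → δ < 1 →
        1 - δ ≤ μ.real {ω |
          1 / ((n : ℝ) * T) * ∑ t ∈ Finset.Icc 1 T, ∑ i,
              ‖gradient (globalCost f) (model W (fun _ => α) G x₁ ξ t i ω)‖ ^ 2 ≤
            K * ((Real.log (1 / δ) + deltaF f x₁
                    + avgSq σ * L * (1 + Real.log (2 * d))) / √(n * T)
                + (n : ℝ) ^ ((3 + ε) / 2) * ρ / (T : ℝ) ^ ((1 + ε) / 2)
                + (Real.log (1 / δ) + deltaF f x₁) / (C * T)
                + L ^ 2 * deltaX x₁ / ((1 - connectivity W ^ 2) * T)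
                + n * avgSq σ * connectivity W ^ 4 * L ^ 2
                    / ((1 - connectivity W ^ 2) ^ 4 * T)
                + n * L ^ 2 * deltaG f x₁ / ((1 - connectivity W ^ 2) ^ 3 * (T : ℝ) ^ 2))} := by
  -- `2304 = 96 / 5 * 120`: the inverse of `5 / 96` times 2 × 1/10 of itself is not involved; it is
  -- `96 / 5`, from dividing by `5 / 96 * α` in the form used by `rate_arith`, times the largest
  -- coefficient there.
  refine ⟨2304, by norm_num, ?_⟩
  intro n d hn hd W _ hW f L hL hf hLip hbdd Ω _ μ _ Ξ _ G ξ hG hξ hind x₁ σ ρ ε C α T hσ hρ hε hT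
    hC hthr hαdef hzero hsub δ hδ hδ1
  have hn0 : 0 < n := by omega
  have hN : (1 : ℝ) ≤ n := by exact_mod_cast hn0
  have hN0 : (0 : ℝ) < n := by linarith
  have hT0 : (0 : ℝ) < T := by exact_mod_cast (by omega : 0 < T)
  have hα0 : 0 < α := by
    rw [hαdef]
    exact lt_min (div_pos (Real.sqrt_pos.2 hN0) (Real.sqrt_pos.2 hT0)) hC
  have hαC : α ≤ C := hαdef ▸ min_le_right _ _
  have hl0 : 0 ≤ connectivity W := norm_nonneg _
  have hl := hthr.sq_lt_one hl0 hL hC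
  have hσsum : ∑ i, σ i ^ 2 = n * avgSq σ := by simp [avgSq, agentMean, hN0.ne']
  have hσi : ∀ i, σ i ^ 2 ≤ n * avgSq σ := fun i =>
    hσsum ▸ Finset.single_le_sum (f := fun i => σ i ^ 2) (fun _ _ => sq_nonneg _)
      (Finset.mem_univ i)
  have hs : 0 < avgSq σ := by
    have h1 := pow_pos (hσ ⟨0, hn0⟩) 2
    exact pos_of_mul_pos_right (h1.trans_le (hσi _)) hN0.le
  have hsm : 0 ≤ maxSq σ := (sq_nonneg _).trans (sq_le_maxSq σ ⟨0, hn0⟩)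
  have hbounds := fun i => noise_weight_bounds (l := connectivity W) hN hL.le hα0.le
    (by linarith : 0 < 1 - connectivity W ^ 2) (hσi i) (sq_le_maxSq σ i)
    (hthr.sq_mul_dimension_le hL hs hd hα0.le hαC)
    (hthr.noiseMax_cube hl0 hl.le hL hsm hα0.le hαC)
  have hgf : ∀ i, Measurable (gradient (f i)) := fun i =>
    (continuous_of_forall_norm_sub_le (hLip i)).measurable
  have hgF : Measurable (gradient (globalCost f)) :=
    (continuous_of_forall_norm_sub_le (norm_gradient_globalCost_sub_le hn0 hf hLip)).measurable
  set Q := α ^ 3 * L ^ 2 * connectivity W ^ 4 / (1 - connectivity W ^ 2) ^ 4 with hQ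
  have hQ0 : 0 ≤ Q := by
    have : 0 < 1 - connectivity W ^ 2 := by linarith
    positivity
  let X : ℕ → Ω → Fin n → Vec d := fun t ω =>
    (gtState W (fun _ => α) G x₁ (fun j s => ξ j s ω) t).x
  let Z : ∀ i, (Fin n → Vec d) × Ξ i → Vec d := fun i p =>
    G i (p.1 i) p.2 - gradient (f i) (p.1 i)
  -- The division by `n` appears because the noises enter as a sum rather than a mean; for the same
  -- reason the quadratic weight carries `n ^ 2`.
  let u : (Fin n → Vec d) → Vec d := fun x => (-(α / n)) • gradient (globalCost f) (agentMean x)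
  let r : Fin n → (Fin n → Vec d) → ℝ := fun i x =>
    α ^ (2 + ε) * ρ * ‖gradient (globalCost f) (x i)‖
  let D : ℕ → Ω → ℝ := fun t ω => inner ℝ (u (X t ω)) (∑ i, Z i (X t ω, ξ i (t + 1) ω))
    + 2 * α ^ 2 * L / n ^ 2 * ‖∑ i, Z i (X t ω, ξ i (t + 1) ω)‖ ^ 2
    + ∑ i, (120 * Q / n * ‖Z i (X t ω, ξ i (t + 1) ω)‖ ^ 2
      - (3 * ‖u (X t ω)‖ ^ 2 * σ i ^ 2
        + (2 * (2 * α ^ 2 * L / n ^ 2) + 120 * Q / n) * σ i ^ 2 + r i (X t ω)))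
  have hZ : ∀ i, Measurable (Z i) := fun i => by
    have hp : Measurable fun p : (Fin n → Vec d) × Ξ i => p.1 i := by fun_prop
    exact ((hG i).comp (hp.prodMk measurable_snd)).sub ((hgf i).comp hp)
  have hmgf := lintegral_exp_sum_range_le (μ := μ) W (fun _ => α) x₁ hG hξ hind (X := X)
    (fun _ _ => rfl) hZ (r := r)
    (fun i => ((hgF.comp (measurable_pi_apply i)).norm.const_mul _))
    (fun i x => by positivity) (u := u) ((hgF.comp measurable_agentMean).fun_const_smul _) hσ
    (fun t i => (hzero (t + 1) (by omega) i).ae_integral_eq_zero hG hξ hind hgf)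
    (fun t i => (hsub (t + 1) (by omega) i).ae_lintegral_le hG hξ hind hgf hgF)
    (a := 2 * α ^ 2 * L / n ^ 2) (b := 120 * Q / n) (by positivity) (by positivity)
    (by rw [hσsum]; exact (hbounds ⟨0, hn0⟩).1) (fun i => (hbounds i).2) (D := D)
    (fun _ _ => rfl) T
  -- All randomness ends here: on the event that the compensated sum is at most `log (1 / δ)`, the
  -- bound holds deterministically.
  refine (one_sub_le_measureReal_le_log (Finset.measurable_fun_sum _ fun t _ => hmgf.1 t) hmgf.2
    hδ).trans (measureReal_mono fun ω hω => ?_)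
  obtain ⟨m, rfl⟩ : ∃ m, T = m + 1 := ⟨T - 1, by omega⟩
  have hrun := isGTRun_gtState W α G x₁ fun j s => ξ j s ω
  have hpath := hrun.sum_norm_sq_local_gradient_le hn0 hW hl hL.le hf hLip hbdd hα0
    (hthr.mul_smooth_le hL hαC) (hthr.consensus_sq hL hα0.le hαC) hρ
    (hthr.mul_noiseAvg_le hs hαC) (hthr.rpow_relaxed_le hρ hε hα0.le hαC) m hQ hω
  rw [← Finset.mul_sum] at hpath
  have hlog : 0 ≤ Real.log (1 / δ) := Real.log_nonneg ((one_le_div hδ).2 hδ1.le)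
  have hΔ : 0 ≤ deltaF f x₁ := sub_nonneg.2 (ciInf_le hbdd _)
  have hd1 : (1 : ℝ) ≤ d := by exact_mod_cast hd
  have hnn : ∀ v : Fin n → ℝ, (∀ i, 0 ≤ v i) → 0 ≤ agentMean v := fun v hv =>
    mul_nonneg (inv_nonneg.2 hN0.le) (Finset.sum_nonneg fun i _ => hv i)
  have hrate := rate_arith hN0 hT0 hC hL hs.le hρ hε hl (add_nonneg hlog hΔ)
    (Real.log_nonneg (by linarith : (1 : ℝ) ≤ 2 * d)) (hnn _ fun _ => sq_nonneg _)
    (hnn _ fun _ => sq_nonneg _) hαdef hpath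
  refine le_trans (le_of_eq ?_) hrate
  have hshift : ∑ t ∈ Finset.Icc 1 (m + 1), ∑ i,
        ‖gradient (globalCost f) (model W (fun _ => α) G x₁ ξ t i ω)‖ ^ 2 =
      ∑ t ∈ Finset.range (m + 1), ∑ i, ‖gradient (globalCost f) (X t ω i)‖ ^ 2 := by
    rw [Finset.range_eq_Ico]
    exact (Finset.sum_Ico_add' (fun t => ∑ i,
      ‖gradient (globalCost f) (model W (fun _ => α) G x₁ ξ t i ω)‖ ^ 2) 0 (m + 1) 1).symm
  rw [hshift, ← Finset.mul_sum]
  simp only [X]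
  field_simp
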